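/- **Setting.** Let $x_1,\dots,x_n\in\mathbb R^d$ with $\|x_i\|=1$ and $y\in\mathbb R^n$ with $|y_i|\le Y$. Consider the two-layer ReLU network $f(W,a,x)=\frac1{\sqrt m}\sum_{r=1}^m a_r\max(\langle w_r,x\rangle,0)$, with $w_r(0)\sim N(0,I)$ and $a_r\sim U(\{-1,+1\})$, all independent. The $a_r$ stay fixed and $W$ is trained on the loss $L(W)=\frac12\|y-u\|^2$, $u_i=f(W,a,x_i)$, by AdaLoss: $$b_{k+1}^2=b_k^2+\alpha^2\sqrt n\,\|y-u(k)\|^2,\qquad W(k+1)=W(k)-\frac{\eta}{b_{k+1}}\frac{\partial L(W(k))}{\partial W},$$ where $b_0,\eta,\alpha>0$ are arbitrary and $\frac{\partial L}{\partial w_r}=\frac1{\sqrt m}\sum_i(u_i-y_i)a_rx_i\mathbb 1\{\langle w_r,x_i\rangle\ge0\}$. Let $H^\infty_{ij}=\mathbb E_{w\sim N(0,I)}\big[\langle x_i,x_j\rangle\mathbb 1\{\langle w,x_i\rangle\ge0,\langle w,x_j\rangle\ge0\}\big]$. Write $\lambda_0$ for its smallest and $\|H^\infty\|$ for its largest eigenvalue,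 and assume $\lambda_0>0$. **Theorem.** For all $Y$ and $C_{\max}$ there is a constant $K>0$, depending on nothing else, such that the following holds for all $n,d,m$, all data as above, all $C\in[1,C_{\max}]$, all $b_0,\eta,\alpha>0$ and all $\delta\in(0,1)$. Put $\theta=\frac{C(\lambda_0+\|H^\infty\|)}2$ and $E(k)=\|y-u(k)\|^2$. *Case (1): $b_0/\eta\ge\theta$.* Let $D=\frac{b_0}{\eta\lambda_0}+\frac{\alpha^2n^{3/2}}{\eta^2\lambda_0^2\delta}$. If $m\ge K\frac{n^8}{\lambda_0^4\delta^3}$, then with probability at least $1-\delta$ over the initialization, $E(k)\le e^{-k/(KD)}E(0)$ for all $k$, and, for every $\varepsilon>0$, $E(k)\le\varepsilon$ for all $k\ge KD\log\!\big(1+\frac{n}{\delta\varepsilon}\big)$. *Case (2): $b_0/\eta<\theta$.* Let $\ell=\log\frac{\eta\theta}{b_0}$ and let $\varepsilon>0$. Put $$T_0=\frac{(\eta\theta)^2-b_0^2}{\alpha^2\sqrt n\,\varepsilon},\qquad D'=\frac{\|H^\infty\|}{\lambda_0}+\frac{\alpha^2n^{3/2}}{\eta^2\lambda_0^2\delta}+\frac{\|H^\infty\|^2}{\lambda_0^2}\ell,\qquad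 E'=\frac n\delta+\frac{\eta^2\|H^\infty\|^2}{\alpha^2\sqrt n}\ell,$$ $$M=\frac{n^8}{\lambda_0^4\delta^3}+\frac{n^6\eta^2\|H^\infty\|^2}{\alpha^2\lambda_0^4\delta^2}\ell+\frac{n^6\eta^2}{\alpha^2\lambda_0^2\delta^2}(1+T_0)(1+\ell).$$ (2a) If $m\ge KM$, then with probability at least $1-\delta$, either $E(k)\le\varepsilon$ for some $k\le T_0$ (the warm-up phase), or $E(k)\le\varepsilon$ for all $k\ge T_0+KD'\log(1+E'/\varepsilon)$. (2b) Let $v$ be a unit eigenvector of $H^\infty$ for the eigenvalue $\|H^\infty\|$, let $\Delta>0$ and $b_*=\max(b_0,\eta\|H^\infty\|/2)$, and put $$N=\frac{b_*^2-b_0^2}{\alpha^2\sqrt n\,\Delta^2},\qquad T_0'=1+KN+\frac{(\eta\theta)^2-b_*^2}{\alpha^2\sqrt n\,\varepsilon}.$$ If $m\ge KM\big(1+\frac{n}{\delta\Delta^2}(1+N)^2\big)$, then with probability at least $1-\delta$: if $|\langle v,y-u(0)\rangle|\ge\Delta$, then either $E(k)\le\varepsilon$ for some $k\le T_0'$, or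 $E(k)\le\varepsilon$ for all $k\ge T_0'+KD'\log(1+E'/\varepsilon)$. -/

import Mathlib

open MeasureTheory ProbabilityTheory
open scoped RealInnerProductSpace

noncomputable section

namespace AdaLoss

/-- The input space `ℝ^d` with its Euclidean structure. -/
abbrev Vec (d : ℕ) : Type := EuclideanSpace ℝ (Fin d)

/-- First-layer weights `W = (w_1, …, w_m)`. -/
abbrev Weights (d m : ℕ) : Type := Fin m → Vec d

/-- The ReLU activation. -/
def relu (z : ℝ) : ℝ := max z 0

/-- The two-layer network `f(W, a, x) = (1/√m) ∑ r, a_r σ(⟨w_r, x⟩)`. -/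
def network {d m : ℕ} (W : Weights d m) (a : Fin m → ℝ) (x : Vec d) : ℝ :=
  (1 / √(m : ℝ)) * ∑ r, a r * relu ⟪W r, x⟫

/-- The vector of residuals `y - u`, where `u_i = f(W, a, x_i)`. -/
def residual {d n m : ℕ} (x : Fin n → Vec d) (y : Fin n → ℝ) (a : Fin m → ℝ)
    (W : Weights d m) (i : Fin n) : ℝ :=
  y i - network W a (x i)

/-- `‖y - u‖²`, which is twice the training loss `L(W) = ½ ‖u - y‖²`. -/
def sqError {d n m : ℕ} (x : Fin n → Vec d) (y : Fin n → ℝ) (a : Fin m → ℝ)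
    (W : Weights d m) : ℝ :=
  ∑ i, residual x y a W i ^ 2

/-- The gradient of the training loss with respect to `w_r`, with the convention
`σ'(z) = 𝟙{z ≥ 0}` for the derivative of the ReLU:
`∂L/∂w_r = (1/√m) ∑ i, (u_i - y_i) a_r x_i 𝟙{⟨w_r, x_i⟩ ≥ 0}`. -/
def lossGrad {d n m : ℕ} (x : Fin n → Vec d) (y : Fin n → ℝ) (a : Fin m → ℝ)
    (W : Weights d m) (r : Fin m) : Vec d :=
  (1 / √(m : ℝ)) • ∑ i, Set.indicator {w : Vec d | 0 ≤ ⟪w, x i⟫}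
    (fun _ => (-(residual x y a W i) * a r) • x i) (W r)

/-- One AdaLoss step on the pair `(W(k), b_k)`:
`b_{k+1}² = b_k² + α² √n ‖y - u(k)‖²` and `W(k+1) = W(k) - (η / b_{k+1}) ∂L(W(k))/∂W`. -/
def step {d n m : ℕ} (x : Fin n → Vec d) (y : Fin n → ℝ) (η α : ℝ) (a : Fin m → ℝ)
    (s : Weights d m × ℝ) : Weights d m × ℝ :=
  let b' : ℝ := √(s.2 ^ 2 + α ^ 2 * √(n : ℝ) * sqError x y a s.1)
  (fun r => s.1 r - (η / b') • lossGrad x y a s.1 r, b')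

/-- The AdaLoss iterates `(W(k), b_k)` started at `(W(0), b_0)`. -/
def iterate {d n m : ℕ} (x : Fin n → Vec d) (y : Fin n → ℝ) (b₀ η α : ℝ) (a : Fin m → ℝ)
    (W₀ : Weights d m) (k : ℕ) : Weights d m × ℝ :=
  (step x y η α a)^[k] (W₀, b₀)

/-- `‖y - u(k)‖²` along AdaLoss, as a function of the random initialization
`ω = (w_r(0), a_r)_r`. The output weights stay fixed. -/
def trainError {d n m : ℕ} (x : Fin n → Vec d) (y : Fin n → ℝ) (b₀ η α : ℝ)
    (ω : Fin m → Vec d × ℝ) (k : ℕ) : ℝ :=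
  sqError x y (fun r => (ω r).2)
    (iterate x y b₀ η α (fun r => (ω r).2) (fun r => (ω r).1) k).1

/-- The component of the initial residual `y - u(0)` along `v`. -/
def initComponent {d n m : ℕ} (x : Fin n → Vec d) (y : Fin n → ℝ) (v : Fin n → ℝ)
    (ω : Fin m → Vec d × ℝ) : ℝ :=
  v ⬝ᵥ residual x y (fun r => (ω r).2) (fun r => (ω r).1)

/-- The law of the initialization: the pairs `(w_r(0), a_r)` are independent over `r`, with
`w_r(0) ∼ N(0, I)` and `a_r ∼ U({-1, +1})` independent of each other. -/
def initLaw (d m : ℕ) : Measure (Fin m → Vec d × ℝ) :=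
  Measure.pi fun _ => (stdGaussian (Vec d)).prod (uniformOn ({-1, 1} : Set ℝ))

/-- The limiting Gram matrix
`H^∞_ij = E_{w ∼ N(0,I)} [⟨x_i, x_j⟩ 𝟙{⟨w, x_i⟩ ≥ 0, ⟨w, x_j⟩ ≥ 0}]`. -/
def gramInf {d n : ℕ} (x : Fin n → Vec d) : Matrix (Fin n) (Fin n) ℝ :=
  Matrix.of fun i j => ∫ w, Set.indicator {w : Vec d | 0 ≤ ⟪w, x i⟫ ∧ 0 ≤ ⟪w, x j⟫}
    (fun _ => ⟪x i, x j⟫) w ∂(stdGaussian (Vec d))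

/-- The smallest eigenvalue `λ₀` of `H^∞`. -/
def lambdaZero {d n : ℕ} (x : Fin n → Vec d) : ℝ := sInf (spectrum ℝ (gramInf x))

/-- `‖H^∞‖`, the largest eigenvalue of `H^∞`. -/
def lambdaMax {d n : ℕ} (x : Fin n → Vec d) : ℝ := sSup (spectrum ℝ (gramInf x))

/-- The critical threshold `C (λ₀ + ‖H^∞‖) / 2` for `b_k / η`. -/
def threshold {d n : ℕ} (x : Fin n → Vec d) (C : ℝ) : ℝ :=
  C * (lambdaZero x + lambdaMax x) / 2

/-- The logarithmic distance `log (η C (λ₀ + ‖H^∞‖) / (2 b₀))` of `b₀` from the threshold. -/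
def logGap {d n : ℕ} (x : Fin n → Vec d) (C b₀ η : ℝ) : ℝ :=
  Real.log (η * threshold x C / b₀)

/-- Time scale of the linear convergence when `b₀` is above the threshold:
`b₀ / (η λ₀) + α² n^{3/2} / (η² λ₀² δ)`. -/
def scaleAbove {d n : ℕ} (x : Fin n → Vec d) (b₀ η α δ : ℝ) : ℝ :=
  b₀ / (η * lambdaZero x)
    + α ^ 2 * (n : ℝ) ^ (3 / 2 : ℝ) / (η ^ 2 * lambdaZero x ^ 2 * δ)

/-- Time scale of the linear convergence after the warm-up phase:
`‖H^∞‖ / λ₀ + α² n^{3/2} / (η² λ₀² δ) + (‖H^∞‖² / λ₀²) log (η C (λ₀ + ‖H^∞‖) / (2 b₀))`. -/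
def scaleBelow {d n : ℕ} (x : Fin n → Vec d) (C b₀ η α δ : ℝ) : ℝ :=
  lambdaMax x / lambdaZero x
    + α ^ 2 * (n : ℝ) ^ (3 / 2 : ℝ) / (η ^ 2 * lambdaZero x ^ 2 * δ)
    + lambdaMax x ^ 2 / lambdaZero x ^ 2 * logGap x C b₀ η

/-- Size of `‖y - u‖²` at the end of the warm-up phase:
`n / δ + (η² ‖H^∞‖² / (α² √n)) log (η C (λ₀ + ‖H^∞‖) / (2 b₀))`. -/
def errorBelow {d n : ℕ} (x : Fin n → Vec d) (C b₀ η α δ : ℝ) : ℝ :=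
  n / δ + η ^ 2 * lambdaMax x ^ 2 / (α ^ 2 * √(n : ℝ)) * logGap x C b₀ η

/-- Length of the warm-up phase: while `‖y - u(k)‖² > ε`, the quantity `b_k²` increases by at
least `α² √n ε` per step, and it has to climb from `b²` to `B²`. -/
def climb (n : ℕ) (α ε b B : ℝ) : ℝ := (B ^ 2 - b ^ 2) / (α ^ 2 * √(n : ℝ) * ε)

/-- Width needed when `b₀` is above the threshold. -/
def widthAbove {d n : ℕ} (x : Fin n → Vec d) (δ : ℝ) : ℝ :=
  (n : ℝ) ^ 8 / (lambdaZero x ^ 4 * δ ^ 3)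

/-- Width needed when `b₀` is below the threshold. -/
def widthBelow {d n : ℕ} (x : Fin n → Vec d) (C b₀ η α δ ε : ℝ) : ℝ :=
  (n : ℝ) ^ 8 / (lambdaZero x ^ 4 * δ ^ 3)
    + (n : ℝ) ^ 6 * η ^ 2 * lambdaMax x ^ 2 / (α ^ 2 * lambdaZero x ^ 4 * δ ^ 2)
        * logGap x C b₀ η
    + (n : ℝ) ^ 6 * η ^ 2 / (α ^ 2 * lambdaZero x ^ 2 * δ ^ 2)
        * (1 + climb n α ε b₀ (η * threshold x C)) * (1 + logGap x C b₀ η)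

end AdaLoss

end

/-!
The proof separates a deterministic dynamical system from the randomness of the initialization.

If every weight stays within a radius `R` of its initial value, only neurons with
`|⟨w_r(0), x_i⟩| ≤ R` can change their activation on `x_i`. Hence a step of AdaLoss acts on the
residual `r_k = y - u(k)` as `r_{k+1} = (I - t (H^∞ + A)) r_k` with `t = η / b_{k+1}`, where `A`
is bounded by the fraction of such neurons and by the distance of the initial Gram matrix from
`H^∞` (`nearlyLinear_of_init`). The weights move by at most `n / √m` times
`∑ (η / b_{j+1}) ‖r_j‖`, so for large `m` everything reduces to bounding this sum, `travel`.

Once `b_{k+1} ≥ η (λ₀ + ‖H^∞‖) / 2`, each step contracts the residual by the factor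
`1 - η λ₀ / (2 b_{k+1})`. This one inequality telescopes in three ways: the remaining travel is at
most `(2 / λ₀) ‖r_s‖`, the sequence `b` stays bounded because its increments are proportional to
the errors, and consequently the errors decay at a fixed linear rate (`sq_norm_add_le`).

Below the threshold nothing contracts, but `α² √n ∑ ‖r_j‖² / b_{j+1}²` is a sum of relative
increments of `b²` and is therefore bounded by twice the logarithm of the total growth of `b`
(`sum_sq_div_le`). This bounds the growth of the error, and, by Cauchy-Schwarz and the bound on the
number of warm-up steps with errors above `ε`, the travel. The contraction then takes over at the
last step below the threshold (`exists_le_or_linear_rate`).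

For the shorter warm-up, while `b_{k+1} ≤ η ‖H^∞‖ / 2` the top eigendirection is amplified by
`t ‖H^∞‖ - 1 ≥ 1`, the largest amplification of all directions. The component along `v` therefore
stays comparable to its initial size relative to the residual, so the error stays above `Δ² / 4`
and `b` climbs at the corresponding speed (`exists_amplification`, `le_climb_of_lt_max`).

The randomness enters only through three second- or first-moment bounds and Markov's inequality:
the initial error has expectation `O(n)`, the squared Frobenius distance of the initial Gram matrix
from `H^∞` has expectation at most `n² / m`, and a neuron lies within `R` of a given activation
boundary with probability at most `R` (`one_sub_le_measureReal_of_goodInit`).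
-/

noncomputable section

namespace AdaLoss

/-! ### Spectral bounds for the limiting Gram matrix -/

/-- What the analysis uses of a symmetric operator whose spectrum lies in `[lam, Lam] ⊆ (0, ∞)`. -/
structure SpectralBounds {E : Type*} [NormedAddCommGroup E] [InnerProductSpace ℝ E]
    (H : E →ₗ[ℝ] E) (lam Lam : ℝ) : Prop where
  pos : 0 < lam
  le : lam ≤ Lam
  symm : H.IsSymmetric
  inner_ge : ∀ z, lam * ‖z‖ ^ 2 ≤ ⟪z, H z⟫
  norm_le : ∀ z, ‖H z‖ ≤ Lam * ‖z‖
  norm_sub_smul_le : ∀ t c z, (∀ μ ∈ Set.Icc lam Lam, |1 - t * μ| ≤ c) → ‖z - t • H z‖ ≤ c * ‖z‖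

/-- Two vectors whose coordinates in an orthonormal basis differ by factors of modulus at most `c`
have norms that differ by a factor of at most `c`. -/
lemma norm_le_of_coord_eq_mul {ι E : Type*} [Fintype ι] [NormedAddCommGroup E]
    [InnerProductSpace ℝ E] (φ : OrthonormalBasis ι ℝ E) (f : ι → ℝ) (c : ℝ) (hc : 0 ≤ c)
    (hf : ∀ i, |f i| ≤ c) (w z : E) (h : ∀ i, ⟪φ i, w⟫ = f i * ⟪φ i, z⟫) : ‖w‖ ≤ c * ‖z‖ := by
  refine le_of_sq_le_sq ?_ (by positivity)
  rw [← φ.sum_sq_inner_right w, mul_pow, ← φ.sum_sq_inner_right z, Finset.mul_sum]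
  refine Finset.sum_le_sum fun i _ => ?_
  rw [h i, mul_pow]
  refine mul_le_mul_of_nonneg_right ?_ (sq_nonneg _)
  rw [← sq_abs]
  exact pow_le_pow_left₀ (abs_nonneg _) (hf i) 2

lemma spectralBounds_of_isHermitian {n : ℕ} [NeZero n] {A : Matrix (Fin n) (Fin n) ℝ}
    (hA : A.IsHermitian) (hpos : 0 < sInf (spectrum ℝ A)) :
    SpectralBounds (Matrix.toEuclideanLin A) (sInf (spectrum ℝ A)) (sSup (spectrum ℝ A)) := by
  have hfin : (spectrum ℝ A).Finite := Matrix.finite_real_spectrum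
  have hmem := hA.eigenvalues_mem_spectrum_real
  have hlo : ∀ i, sInf (spectrum ℝ A) ≤ hA.eigenvalues i :=
    fun i => csInf_le hfin.bddBelow (hmem i)
  have hhi : ∀ i, hA.eigenvalues i ≤ sSup (spectrum ℝ A) :=
    fun i => le_csSup hfin.bddAbove (hmem i)
  have hle : sInf (spectrum ℝ A) ≤ sSup (spectrum ℝ A) := (hlo 0).trans (hhi 0)
  have hsymm : (Matrix.toEuclideanLin A).IsSymmetric :=
    Matrix.isSymmetric_toEuclideanLin_iff.mpr hA
  have hcoord : ∀ i z, ⟪hA.eigenvectorBasis i, Matrix.toEuclideanLin A z⟫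
      = hA.eigenvalues i * ⟪hA.eigenvectorBasis i, z⟫ := by
    intro i z
    rw [← hsymm]
    have : Matrix.toEuclideanLin A (hA.eigenvectorBasis i)
        = hA.eigenvalues i • hA.eigenvectorBasis i := by
      have h := hA.mulVec_eigenvectorBasis i
      apply (WithLp.ofLp_injective 2)
      simpa using h
    rw [this, real_inner_smul_left]
  refine ⟨hpos, hle, hsymm, fun z => ?_, fun z => ?_, fun t c z hc => ?_⟩
  · rw [← hA.eigenvectorBasis.sum_sq_inner_right z, Finset.mul_sum,
      ← hA.eigenvectorBasis.sum_inner_mul_inner z]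
    refine Finset.sum_le_sum fun i _ => ?_
    rw [hcoord, real_inner_comm]
    nlinarith [mul_le_mul_of_nonneg_right (hlo i) (sq_nonneg ⟪z, hA.eigenvectorBasis i⟫)]
  · refine norm_le_of_coord_eq_mul hA.eigenvectorBasis hA.eigenvalues _ (hpos.le.trans hle)
      (fun i => ?_) _ _ fun i => hcoord i z
    rw [abs_of_nonneg (hpos.le.trans (hlo i))]
    exact hhi i
  · refine norm_le_of_coord_eq_mul hA.eigenvectorBasis (fun i => 1 - t * hA.eigenvalues i) _
      ((abs_nonneg _).trans (hc _ ⟨le_rfl, hle⟩)) (fun i => hc _ ⟨hlo i, hhi i⟩) _ _ fun i => ?_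
    rw [inner_sub_right, real_inner_smul_right, hcoord]
    ring

lemma gramInf_isHermitian {d n : ℕ} (x : Fin n → Vec d) : (gramInf x).IsHermitian := by
  ext i j
  simp only [gramInf, Matrix.conjTranspose_apply, Matrix.of_apply, star_trivial, real_inner_comm,
    and_comm]

lemma lambdaZero_eq_zero_of_isEmpty {d : ℕ} (x : Fin 0 → Vec d) : lambdaZero x = 0 := by
  simp [lambdaZero]

lemma spectralBounds_gramInf {d n : ℕ} {x : Fin n → Vec d} (hpos : 0 < lambdaZero x) :
    SpectralBounds (Matrix.toEuclideanLin (gramInf x)) (lambdaZero x) (lambdaMax x) := by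
  have : NeZero n := by
    refine ⟨?_⟩
    rintro rfl
    rw [lambdaZero_eq_zero_of_isEmpty] at hpos
    exact lt_irrefl _ hpos
  exact spectralBounds_of_isHermitian (gramInf_isHermitian x) hpos

lemma lambdaZero_le_one {d n : ℕ} {x : Fin n → Vec d} (hx : ∀ i, ‖x i‖ = 1)
    (hpos : 0 < lambdaZero x) : lambdaZero x ≤ 1 := by
  obtain _ | n := n
  · rw [lambdaZero_eq_zero_of_isEmpty]
    exact zero_le_one
  have h := (spectralBounds_gramInf hpos).inner_ge (EuclideanSpace.single 0 1)
  have h1 : ⟪EuclideanSpace.single (0 : Fin (n + 1)) (1 : ℝ),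
      Matrix.toEuclideanLin (gramInf x) (EuclideanSpace.single 0 1)⟫ = gramInf x 0 0 := by
    rw [EuclideanSpace.inner_single_left]
    simp
  have h2 : gramInf x 0 0 ≤ 1 := by
    have : gramInf x 0 0 ≤ ∫ _w, (1 : ℝ) ∂(stdGaussian (Vec d)) := by
      refine integral_mono_of_nonneg (Filter.Eventually.of_forall fun w => ?_)
        (integrable_const _) (Filter.Eventually.of_forall fun w => ?_)
      · exact Set.indicator_nonneg (fun _ _ => real_inner_self_nonneg) _
      · refine Set.indicator_apply_le' (fun _ => ?_) (fun _ => zero_le_one)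
        simp [hx]
    simpa using this
  rw [h1] at h
  simp only [PiLp.norm_single, norm_one, one_pow, mul_one] at h
  exact h.trans h2

/-! ### Adaptive gradient steps that are nearly linear in the residual -/

section Dynamics

variable {E : Type*} [NormedAddCommGroup E]

/-- The accumulated step lengths `∑ j < k, (η / b_{j+1}) ‖r_j‖`. Up to a factor, this bounds the
distance travelled by each weight vector in the first `k` steps. -/
def travel (η : ℝ) (b : ℕ → ℝ) (r : ℕ → E) (k : ℕ) : ℝ :=
  ∑ j ∈ Finset.range k, η / b (j + 1) * ‖r j‖

lemma travel_succ (η : ℝ) (b : ℕ → ℝ) (r : ℕ → E) (k : ℕ) :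
    travel η b r (k + 1) = travel η b r k + η / b (k + 1) * ‖r k‖ :=
  Finset.sum_range_succ _ _

variable [InnerProductSpace ℝ E]

/-- Residuals `r` and step-size denominators `b` such that `b_{k+1}² = b_k² + β ‖r_k‖²`, and such
that `r_{k+1} = (I - t H) r_k` with `t = η / b_{k+1}`, up to an error `t ρ ‖r_k‖`, for as long as
the accumulated step lengths stay below `S`. -/
structure NearlyLinear (H : E →ₗ[ℝ] E) (η β ρ S : ℝ) (r : ℕ → E) (b : ℕ → ℝ) : Prop where
  b_pos : ∀ k, 0 < b k
  b_sq : ∀ k, b (k + 1) ^ 2 = b k ^ 2 + β * ‖r k‖ ^ 2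
  norm_error_le : ∀ k, travel η b r (k + 1) ≤ S →
    ‖r (k + 1) - (r k - (η / b (k + 1)) • H (r k))‖ ≤ η / b (k + 1) * (ρ * ‖r k‖)

variable {H : E →ₗ[ℝ] E} {η β ρ S lam Lam : ℝ} {r : ℕ → E} {b : ℕ → ℝ}

namespace NearlyLinear

lemma b_mono (h : NearlyLinear H η β ρ S r b) (hβ : 0 < β) : Monotone b := by
  refine monotone_nat_of_le_succ fun k => ?_
  refine le_of_sq_le_sq ?_ (h.b_pos _).le
  rw [h.b_sq]
  have : 0 ≤ β * ‖r k‖ ^ 2 := by positivity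
  linarith

lemma travel_mono (h : NearlyLinear H η β ρ S r b) (hη : 0 < η) : Monotone (travel η b r) := by
  refine monotone_nat_of_le_succ fun k => ?_
  rw [travel_succ]
  have := h.b_pos (k + 1)
  have : 0 ≤ η / b (k + 1) * ‖r k‖ := by positivity
  linarith

lemma b_sq_add_ge (h : NearlyLinear H η β ρ S r b) (hβ : 0 < β) {ε : ℝ} (s k : ℕ)
    (hε : ∀ j, s ≤ j → j < s + k → ε ≤ ‖r j‖ ^ 2) :
    b s ^ 2 + k * (β * ε) ≤ b (s + k) ^ 2 := by
  induction k with
  | zero => simp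
  | succ k ih =>
    have h1 := ih fun j h1 h2 => hε j h1 (by omega)
    have h2 := h.b_sq (s + k)
    have h3 := mul_le_mul_of_nonneg_left (hε (s + k) (by omega) (by omega)) hβ.le
    rw [← add_assoc, h2]
    push_cast
    linarith

/-- While the errors exceed `ε`, climbing from `b_s` to a level `B` takes at most
`(B² - b_s²) / (β ε)` steps. -/
lemma steps_le_climb (h : NearlyLinear H η β ρ S r b) (hβ : 0 < β) {ε B : ℝ} (hε : 0 < ε)
    (s k : ℕ) (hr : ∀ j, s ≤ j → j < s + k → ε ≤ ‖r j‖ ^ 2) (hB : b (s + k) ≤ B) :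
    (k : ℝ) ≤ (B ^ 2 - b s ^ 2) / (β * ε) := by
  rw [le_div_iff₀ (by positivity)]
  have h1 := h.b_sq_add_ge hβ s k hr
  have h2 := pow_le_pow_left₀ (h.b_pos _).le hB 2
  linarith

lemma sum_sq_div_le (h : NearlyLinear H η β ρ S r b) (hβ : 0 < β) (k : ℕ) :
    ∑ j ∈ Finset.range k, (‖r j‖ / b (j + 1)) ^ 2 ≤ 2 / β * Real.log (b k / b 0) := by
  induction k with
  | zero => simp [(h.b_pos 0).ne']
  | succ k ih =>
    have hk := h.b_pos k
    have hk1 := h.b_pos (k + 1)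
    have h0 := h.b_pos 0
    rw [Finset.sum_range_succ]
    have h1 : Real.log (b (k + 1) / b 0) = Real.log (b k / b 0) + Real.log (b (k + 1) / b k) := by
      rw [← Real.log_mul (by positivity) (by positivity)]
      congr 1
      field_simp
    have h2 : (‖r k‖ / b (k + 1)) ^ 2 ≤ 2 / β * Real.log (b (k + 1) / b k) := by
      -- `log z ≥ 1 - 1 / z` for `z = b_{k+1}² / b_k²`
      have h3 := Real.one_sub_inv_le_log_of_pos (x := (b (k + 1) / b k) ^ 2) (by positivity)
      rw [Real.log_pow] at h3
      have h4 : 1 - ((b (k + 1) / b k) ^ 2)⁻¹ = β * (‖r k‖ / b (k + 1)) ^ 2 := by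
        have := h.b_sq k
        field_simp
        linarith
      rw [h4] at h3
      push_cast at h3
      rw [div_mul_eq_mul_div, le_div_iff₀ hβ]
      linarith
    rw [h1, mul_add]
    linarith

lemma sq_travel_le (h : NearlyLinear H η β ρ S r b) (hβ : 0 < β) (k : ℕ) :
    travel η b r k ^ 2 ≤ η ^ 2 * k * (2 / β * Real.log (b k / b 0)) := by
  have h1 := sq_sum_le_card_mul_sum_sq (s := Finset.range k)
    (f := fun j => η / b (j + 1) * ‖r j‖)
  have h2 := h.sum_sq_div_le hβ k
  have h3 : ∑ j ∈ Finset.range k, (η / b (j + 1) * ‖r j‖) ^ 2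
      = η ^ 2 * ∑ j ∈ Finset.range k, (‖r j‖ / b (j + 1)) ^ 2 := by
    rw [Finset.mul_sum]
    refine Finset.sum_congr rfl fun j _ => ?_
    ring
  rw [h3, Finset.card_range] at h1
  calc travel η b r k ^ 2 ≤ k * (η ^ 2 * ∑ j ∈ Finset.range k, (‖r j‖ / b (j + 1)) ^ 2) := h1
    _ = η ^ 2 * k * ∑ j ∈ Finset.range k, (‖r j‖ / b (j + 1)) ^ 2 := by ring
    _ ≤ _ := by gcongr

/-- Without any restriction on the step size the error grows by the factor
`1 + (3 / 2 · Lam η / b_{k+1})²` at most, because the linear part of the decrease is nonnegative. -/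
lemma sq_norm_succ_le (h : NearlyLinear H η β ρ S r b) (hH : SpectralBounds H lam Lam)
    (hη : 0 < η) (hρ : ρ ≤ lam / 2) (k : ℕ) (hk : travel η b r (k + 1) ≤ S) :
    ‖r (k + 1)‖ ^ 2 ≤ ‖r k‖ ^ 2 + (3 / 2 * Lam * η) ^ 2 * (‖r k‖ / b (k + 1)) ^ 2 := by
  have hb := h.b_pos (k + 1)
  have herr := h.norm_error_le k hk
  set t := η / b (k + 1) with ht
  have htp : 0 < t := by positivity
  set e := r (k + 1) - (r k - t • H (r k)) with he
  have hlam := hH.pos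
  have hle := hH.le
  have heq : r (k + 1) = r k - (t • H (r k) - e) := by rw [he]; abel
  have hn := norm_nonneg (r k)
  have herr' : ‖e‖ ≤ t * (lam / 2 * ‖r k‖) := herr.trans (by gcongr)
  have hin : 0 ≤ ⟪r k, t • H (r k) - e⟫ := by
    rw [inner_sub_right, real_inner_smul_right]
    have h1 := mul_le_mul_of_nonneg_left (hH.inner_ge (r k)) htp.le
    have h2 := real_inner_le_norm (r k) e
    have h3 := mul_le_mul_of_nonneg_left herr' hn
    nlinarith [mul_nonneg (mul_nonneg htp.le hlam.le) (sq_nonneg ‖r k‖)]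
  have hG : ‖t • H (r k) - e‖ ≤ 3 / 2 * Lam * t * ‖r k‖ := by
    have h1 := norm_sub_le (t • H (r k)) e
    rw [norm_smul, Real.norm_of_nonneg htp.le] at h1
    have h2 := mul_le_mul_of_nonneg_left (hH.norm_le (r k)) htp.le
    have h3 : t * (lam / 2 * ‖r k‖) ≤ t * (Lam / 2 * ‖r k‖) := by gcongr
    linarith
  have h4 := pow_le_pow_left₀ (norm_nonneg _) hG 2
  have h5 : (3 / 2 * Lam * t * ‖r k‖) ^ 2
      = (3 / 2 * Lam * η) ^ 2 * (‖r k‖ / b (k + 1)) ^ 2 := by rw [ht]; ring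
  rw [heq, norm_sub_sq_real]
  linarith

lemma sq_norm_le_of_travel_le (h : NearlyLinear H η β ρ S r b) (hH : SpectralBounds H lam Lam)
    (hη : 0 < η) (hβ : 0 < β) (hρ : ρ ≤ lam / 2) (k : ℕ) (hk : travel η b r k ≤ S) :
    ‖r k‖ ^ 2 ≤ ‖r 0‖ ^ 2 + 9 / 2 * (Lam ^ 2 * η ^ 2 / β * Real.log (b k / b 0)) := by
  have key : ∀ j ≤ k, ‖r j‖ ^ 2 ≤ ‖r 0‖ ^ 2
      + (3 / 2 * Lam * η) ^ 2 * ∑ i ∈ Finset.range j, (‖r i‖ / b (i + 1)) ^ 2 := by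
    intro j
    induction j with
    | zero => simp
    | succ j ih =>
      intro hj
      have h1 := h.sq_norm_succ_le hH hη hρ j ((h.travel_mono hη hj).trans hk)
      have h2 := ih (by omega)
      rw [Finset.sum_range_succ, mul_add]
      linarith
  refine (key k le_rfl).trans ?_
  have h1 := mul_le_mul_of_nonneg_left (h.sum_sq_div_le hβ k) (sq_nonneg (3 / 2 * Lam * η))
  have h2 : (3 / 2 * Lam * η) ^ 2 * (2 / β * Real.log (b k / b 0))
      = 9 / 2 * (Lam ^ 2 * η ^ 2 / β * Real.log (b k / b 0)) := by ring
  linarith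

/-- Above the critical threshold `b_{k+1} / η ≥ (lam + Lam) / 2` each step is a contraction. -/
lemma norm_succ_le (h : NearlyLinear H η β ρ S r b) (hH : SpectralBounds H lam Lam)
    (hη : 0 < η) (hρ : ρ ≤ lam / 2) (k : ℕ) (hb : η * (lam + Lam) / 2 ≤ b (k + 1))
    (hk : travel η b r (k + 1) ≤ S) :
    ‖r (k + 1)‖ ≤ (1 - η * lam / (2 * b (k + 1))) * ‖r k‖ := by
  have hbp := h.b_pos (k + 1)
  have herr := h.norm_error_le k hk
  have ht2 : η * lam / (2 * b (k + 1)) = η / b (k + 1) * lam / 2 := by field_simp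
  have ht1 : η / b (k + 1) * (lam + Lam) ≤ 2 := by
    rw [div_mul_eq_mul_div, div_le_iff₀ hbp]
    linarith
  rw [ht2]
  set t := η / b (k + 1) with ht
  have htp : 0 < t := by positivity
  have hlin : ‖r k - t • H (r k)‖ ≤ (1 - t * lam) * ‖r k‖ := by
    refine hH.norm_sub_smul_le t _ _ fun μ hμ => ?_
    have h1 := mul_le_mul_of_nonneg_left hμ.1 htp.le
    have h2 := mul_le_mul_of_nonneg_left hμ.2 htp.le
    rw [abs_le]
    constructor <;> linarith
  have h1 := norm_add_le (r (k + 1) - (r k - t • H (r k))) (r k - t • H (r k))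
  rw [sub_add_cancel] at h1
  have h2 : t * (ρ * ‖r k‖) ≤ t * (lam / 2 * ‖r k‖) := by gcongr
  linarith

/-- In the contraction regime the remaining travel is at most `(2 / lam) ‖r_s‖`, so a budget `S`
that has room for it is never exceeded. -/
lemma travel_add_le (h : NearlyLinear H η β ρ S r b) (hH : SpectralBounds H lam Lam)
    (hη : 0 < η) (hβ : 0 < β) (hρ : ρ ≤ lam / 2) (s : ℕ) (hb : η * (lam + Lam) / 2 ≤ b (s + 1))
    (hs : travel η b r s + 2 / lam * ‖r s‖ ≤ S) (k : ℕ) :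
    travel η b r (s + k) + 2 / lam * ‖r (s + k)‖ ≤ S ∧ travel η b r (s + k + 1) ≤ S := by
  have hlam := hH.pos
  have step : ∀ j, travel η b r (s + j) + 2 / lam * ‖r (s + j)‖ ≤ S →
      travel η b r (s + j + 1) ≤ S := by
    intro j hj
    refine le_trans ?_ hj
    rw [travel_succ]
    have hbp := h.b_pos (s + j + 1)
    have hb' : η * (lam + Lam) / 2 ≤ b (s + j + 1) := hb.trans (h.b_mono hβ (by omega))
    have h1 : η / b (s + j + 1) ≤ 2 / lam := by
      rw [div_le_div_iff₀ hbp hlam]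
      nlinarith [hH.le]
    gcongr
  induction k with
  | zero => exact ⟨hs, step 0 hs⟩
  | succ k ih =>
    suffices hsuff : travel η b r (s + (k + 1)) + 2 / lam * ‖r (s + (k + 1))‖ ≤ S from
      ⟨hsuff, step _ hsuff⟩
    refine le_trans ?_ ih.1
    have hbp := h.b_pos (s + k + 1)
    have hb' : η * (lam + Lam) / 2 ≤ b (s + k + 1) := hb.trans (h.b_mono hβ (by omega))
    have h1 := mul_le_mul_of_nonneg_left (h.norm_succ_le hH hη hρ (s + k) hb' ih.2)
      (show 0 ≤ 2 / lam by positivity)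
    rw [← add_assoc, travel_succ]
    have h2 : 2 / lam * ((1 - η * lam / (2 * b (s + k + 1))) * ‖r (s + k)‖)
        = 2 / lam * ‖r (s + k)‖ - η / b (s + k + 1) * ‖r (s + k)‖ := by
      field_simp
    linarith

/-- The increments of `b` are summable against the decrease of the error, so `b` stays bounded. -/
lemma b_add_le (h : NearlyLinear H η β ρ S r b) (hH : SpectralBounds H lam Lam)
    (hη : 0 < η) (hβ : 0 < β) (hρ : ρ ≤ lam / 2) (s : ℕ) (hb : η * (lam + Lam) / 2 ≤ b (s + 1))
    (hs : travel η b r s + 2 / lam * ‖r s‖ ≤ S) (k : ℕ) :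
    b (s + k) + 2 * β / (η * lam) * ‖r (s + k)‖ ^ 2
      ≤ b s + 2 * β / (η * lam) * ‖r s‖ ^ 2 := by
  have hlam := hH.pos
  induction k with
  | zero => simp
  | succ k ih =>
    refine le_trans ?_ ih
    rw [← add_assoc]
    have hb0 := h.b_pos (s + k)
    have hbp := h.b_pos (s + k + 1)
    have hb' : η * (lam + Lam) / 2 ≤ b (s + k + 1) := hb.trans (h.b_mono hβ (by omega))
    have h1 := h.norm_succ_le hH hη hρ (s + k) hb' (h.travel_add_le hH hη hβ hρ s hb hs k).2
    have h2 := h.b_sq (s + k)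
    have hle : b (s + k) ≤ b (s + k + 1) := h.b_mono hβ (by omega)
    have hn := norm_nonneg (r (s + k))
    set q := η * lam / (2 * b (s + k + 1)) with hq
    have hq0 : 0 < q := by positivity
    have hq1 : q ≤ 1 := by
      rw [hq, div_le_one (by positivity)]
      nlinarith [hH.le]
    have h3 : ‖r (s + k + 1)‖ ^ 2 ≤ (1 - q) * ‖r (s + k)‖ ^ 2 := by
      have := pow_le_pow_left₀ (norm_nonneg _) h1 2
      rw [mul_pow] at this
      refine this.trans (mul_le_mul_of_nonneg_right ?_ (sq_nonneg _))
      nlinarith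
    have h4 : b (s + k + 1) - b (s + k) ≤ β * ‖r (s + k)‖ ^ 2 / b (s + k + 1) := by
      rw [le_div_iff₀ hbp]
      nlinarith
    have h5 : 2 * β / (η * lam) * (q * ‖r (s + k)‖ ^ 2)
        = β * ‖r (s + k)‖ ^ 2 / b (s + k + 1) := by
      rw [hq]
      field_simp
    have h6 := mul_le_mul_of_nonneg_left h3 (show 0 ≤ 2 * β / (η * lam) by positivity)
    linarith

/-- Linear convergence from a step `s` on, once the threshold is passed at `s + 1`. -/
lemma sq_norm_add_le (h : NearlyLinear H η β ρ S r b) (hH : SpectralBounds H lam Lam)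
    (hη : 0 < η) (hβ : 0 < β) (hρ : ρ ≤ lam / 2) (s : ℕ) (hb : η * (lam + Lam) / 2 ≤ b (s + 1))
    (hs : travel η b r s + 2 / lam * ‖r s‖ ≤ S) {τ : ℝ}
    (hτ : 2 * (b s + 2 * β / (η * lam) * ‖r s‖ ^ 2) / (η * lam) ≤ τ) (k : ℕ) :
    ‖r (s + k)‖ ^ 2 ≤ Real.exp (-(k / τ)) * ‖r s‖ ^ 2 := by
  have hlam := hH.pos
  have hbs := h.b_pos s
  have hτ0 : 0 < τ := lt_of_lt_of_le (by positivity) hτ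
  induction k with
  | zero => simp
  | succ k ih =>
    have hbp := h.b_pos (s + k + 1)
    have hb' : η * (lam + Lam) / 2 ≤ b (s + k + 1) := hb.trans (h.b_mono hβ (by omega))
    have h1 := h.norm_succ_le hH hη hρ (s + k) hb' (h.travel_add_le hH hη hβ hρ s hb hs k).2
    have hB : b (s + k + 1) ≤ b s + 2 * β / (η * lam) * ‖r s‖ ^ 2 := by
      have h2 := h.b_add_le hH hη hβ hρ s hb hs (k + 1)
      rw [← add_assoc] at h2
      have h3 : 0 ≤ 2 * β / (η * lam) * ‖r (s + k + 1)‖ ^ 2 := by positivity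
      linarith
    set q := η * lam / (2 * b (s + k + 1)) with hq
    have hq1 : q ≤ 1 := by
      rw [hq, div_le_one (by positivity)]
      nlinarith [hH.le]
    have hτq : 1 / τ ≤ q := by
      rw [hq, div_le_div_iff₀ hτ0 (by positivity), one_mul]
      rw [div_le_iff₀ (by positivity)] at hτ
      linarith
    have hq0 : 0 < q := by positivity
    have h3 : ‖r (s + k + 1)‖ ^ 2 ≤ (1 - q) * ‖r (s + k)‖ ^ 2 := by
      have := pow_le_pow_left₀ (norm_nonneg _) h1 2
      rw [mul_pow] at this
      refine this.trans (mul_le_mul_of_nonneg_right ?_ (sq_nonneg _))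
      nlinarith
    have h4 : 1 - q ≤ Real.exp (-(1 / τ)) := by
      have := Real.add_one_le_exp (-(1 / τ))
      linarith
    rw [← add_assoc]
    calc ‖r (s + k + 1)‖ ^ 2 ≤ (1 - q) * ‖r (s + k)‖ ^ 2 := h3
      _ ≤ Real.exp (-(1 / τ)) * (Real.exp (-(k / τ)) * ‖r s‖ ^ 2) := by gcongr
      _ = Real.exp (-((k + 1 : ℕ) / τ)) * ‖r s‖ ^ 2 := by
        rw [← mul_assoc, ← Real.exp_add]
        congr 2
        push_cast
        ring

end NearlyLinear
end Dynamics

/-! ### Warm-up below the critical threshold -/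

section WarmUp

variable {E : Type*} [NormedAddCommGroup E] [InnerProductSpace ℝ E]
  {H : E →ₗ[ℝ] E} {η β ρ S lam Lam : ℝ} {r : ℕ → E} {b : ℕ → ℝ}

namespace NearlyLinear

/-- As long as `b` is below `B` and the errors exceed `ε`, the number of steps is bounded by the
climbing time, and Cauchy-Schwarz turns this into a bound on the travel. -/
lemma travel_le_of_lt (h : NearlyLinear H η β ρ S r b) (hη : 0 < η) (hβ : 0 < β) {ε B : ℝ}
    (hε : 0 < ε) {k : ℕ} (hk : b k < B) (hr : ∀ j < k, ε < ‖r j‖ ^ 2) :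
    travel η b r k
      ≤ √(η ^ 2 * ((B ^ 2 - b 0 ^ 2) / (β * ε)) * (2 / β * Real.log (B / b 0))) := by
  refine Real.le_sqrt_of_sq_le ((h.sq_travel_le hβ k).trans ?_)
  have hb0 := h.b_pos 0
  have hbk := h.b_pos k
  have h1 : (k : ℝ) ≤ (B ^ 2 - b 0 ^ 2) / (β * ε) :=
    h.steps_le_climb hβ hε 0 k (fun j _ hj => (hr j (by omega)).le) (by simpa using hk.le)
  have h2 : 0 ≤ Real.log (b k / b 0) :=
    Real.log_nonneg ((one_le_div hb0).mpr (h.b_mono hβ (Nat.zero_le k)))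
  gcongr
  exact mul_nonneg (sq_nonneg _) ((Nat.cast_nonneg k).trans h1)

/-- Either an error of at most `ε` occurs up to time `T`, or linear convergence starts before `T`.
Here `T` is any bound on the number of steps with `b_k < B` and errors above `ε`. -/
theorem exists_le_or_linear_rate (h : NearlyLinear H η β ρ S r b)
    (hH : SpectralBounds H lam Lam) (hη : 0 < η) (hβ : 0 < β) (hρ : ρ ≤ lam / 2)
    {ε B T E₁ τ : ℝ} (hε : 0 < ε) (hB : b 0 < B) (hBt : η * (lam + Lam) / 2 ≤ B)
    (hE₁ : ‖r 0‖ ^ 2 + 9 / 2 * (Lam ^ 2 * η ^ 2 / β * Real.log (B / b 0)) ≤ E₁)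
    (hS : √(η ^ 2 * ((B ^ 2 - b 0 ^ 2) / (β * ε)) * (2 / β * Real.log (B / b 0)))
      + 2 / lam * √E₁ ≤ S)
    (hT0 : 0 ≤ T) (hT : ∀ k, b k < B → (∀ j < k, ε < ‖r j‖ ^ 2) → (k : ℝ) ≤ T)
    (hτ : 2 * (B + 2 * β / (η * lam) * E₁) / (η * lam) ≤ τ) :
    (∃ k : ℕ, (k : ℝ) ≤ T ∧ ‖r k‖ ^ 2 ≤ ε) ∨
      ∃ s : ℕ, (s : ℝ) ≤ T ∧ ∀ k : ℕ, ‖r (s + k)‖ ^ 2 ≤ Real.exp (-(k / τ)) * E₁ := by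
  classical
  have hlam := hH.pos
  by_cases hex : ∃ k : ℕ, (k : ℝ) ≤ T ∧ ‖r k‖ ^ 2 ≤ ε
  · exact Or.inl hex
  right
  push Not at hex
  have hpass : ∃ k, B ≤ b k := by
    refine ⟨⌊T⌋₊ + 1, ?_⟩
    by_contra! hlt
    have h1 := hT _ hlt fun j hj =>
      hex j ((Nat.le_floor_iff hT0).mp (Nat.lt_succ_iff.mp hj))
    have h2 := Nat.lt_floor_add_one T
    push_cast at h1
    linarith
  obtain ⟨s, hs⟩ : ∃ s, Nat.find hpass = s + 1 := by
    refine Nat.exists_eq_succ_of_ne_zero fun h0 => ?_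
    have := Nat.find_spec hpass
    rw [h0] at this
    linarith
  have hs1 : B ≤ b (s + 1) := by
    have := Nat.find_spec hpass
    rwa [hs] at this
  have hsB : b s < B := by
    have := Nat.find_min hpass (m := s) (by omega)
    linarith
  have hlt : ∀ j < s, ε < ‖r j‖ ^ 2 := by
    intro j hj
    refine hex j ?_
    by_contra! hTj
    -- the first `⌊T⌋ + 1` errors exceed `ε`, so `b` would pass `B` before `s`
    have hfl : ⌊T⌋₊ + 1 ≤ j := (Nat.floor_lt hT0).mpr hTj
    have h1 := hT (⌊T⌋₊ + 1) ((h.b_mono hβ (by omega)).trans_lt hsB) fun i hi =>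
      hex i ((Nat.le_floor_iff hT0).mp (Nat.lt_succ_iff.mp hi))
    have h2 := Nat.lt_floor_add_one T
    push_cast at h1
    linarith
  have hsT : (s : ℝ) ≤ T := hT s hsB hlt
  have htr := h.travel_le_of_lt hη hβ hε hsB hlt
  have hEs : ‖r s‖ ^ 2 ≤ E₁ := by
    refine le_trans (h.sq_norm_le_of_travel_le hH hη hβ hρ s ?_) (le_trans ?_ hE₁)
    · refine htr.trans (le_trans ?_ hS)
      have : 0 ≤ 2 / lam * √E₁ := by positivity
      linarith
    · have hb0 := h.b_pos 0
      have hbs := h.b_pos s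
      gcongr
  have hns : ‖r s‖ ≤ √E₁ := Real.le_sqrt_of_sq_le hEs
  have hbud : travel η b r s + 2 / lam * ‖r s‖ ≤ S := by
    refine le_trans ?_ hS
    gcongr
  refine ⟨s, hsT, fun k => ?_⟩
  refine (h.sq_norm_add_le hH hη hβ hρ s (hBt.trans hs1) hbud (τ := τ) ?_ k).trans ?_
  · refine le_trans ?_ hτ
    gcongr
  · gcongr

/-- While `b_k ≤ η Lam / 2`, every step amplifies the component along a top eigenvector `v` by
`t Lam - 1 ≥ 1`, and no direction is amplified by more. With `G` the product of these factors, the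
errors of the linearization cost at most a factor `1 + 2 ρ / Lam` per step. -/
lemma exists_amplification (h : NearlyLinear H η β ρ S r b) (hH : SpectralBounds H lam Lam)
    (hη : 0 < η) (hβ : 0 < β) (hρ0 : 0 ≤ ρ) {v : E} (hv : ‖v‖ = 1) (hHv : H v = Lam • v)
    (k : ℕ) (hb : b k ≤ η * Lam / 2) (hk : travel η b r k ≤ S) :
    ∃ G : ℝ, 1 ≤ G ∧ ‖r k‖ ≤ G * ((1 + 2 * ρ / Lam) ^ k * ‖r 0‖) ∧
      G * (|⟪v, r 0⟫| - ((1 + 2 * ρ / Lam) ^ k - 1) * ‖r 0‖) ≤ |⟪v, r k⟫| := by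
  have hLam : 0 < Lam := hH.pos.trans_le hH.le
  induction k with
  | zero => exact ⟨1, le_rfl, by simp, by simp⟩
  | succ k ih =>
    obtain ⟨G, hG1, hGn, hGv⟩ := ih ((h.b_mono hβ (by omega)).trans hb)
      ((h.travel_mono hη (by omega)).trans hk)
    have hbp := h.b_pos (k + 1)
    have herr := h.norm_error_le k hk
    have htL : 2 ≤ η / b (k + 1) * Lam := by
      rw [div_mul_eq_mul_div, le_div_iff₀ hbp]
      linarith
    set t := η / b (k + 1) with ht
    have htp : 0 < t := by positivity
    set e := r (k + 1) - (r k - t • H (r k)) with he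
    set τ := 2 * ρ / Lam with hτ
    have hτ0 : 0 ≤ τ := by positivity
    have hg1 : 1 ≤ t * Lam - 1 := by linarith
    have hn := norm_nonneg (r k)
    have hρτ : ρ = τ * Lam / 2 := by
      rw [hτ]
      field_simp
    -- the error of a step is at most `τ` times its amplification
    have herr' : ‖e‖ ≤ (t * Lam - 1) * (τ * ‖r k‖) := by
      refine herr.trans ?_
      rw [hρτ]
      have : t * Lam / 2 * (τ * ‖r k‖) ≤ (t * Lam - 1) * (τ * ‖r k‖) := by
        gcongr
        linarith
      linarith
    have hlin : ‖r k - t • H (r k)‖ ≤ (t * Lam - 1) * ‖r k‖ := by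
      refine hH.norm_sub_smul_le t _ _ fun μ hμ => ?_
      have hlam := hH.pos
      have h1 := mul_le_mul_of_nonneg_left hμ.1 htp.le
      have h2 := mul_le_mul_of_nonneg_left hμ.2 htp.le
      have h3 : 0 ≤ t * lam := by positivity
      rw [abs_le]
      constructor <;> linarith
    have heq : r (k + 1) = e + (r k - t • H (r k)) := by rw [he]; abel
    have hnorm : ‖r (k + 1)‖ ≤ (t * Lam - 1) * ((1 + τ) * ‖r k‖) := by
      rw [heq]
      have := norm_add_le e (r k - t • H (r k))
      linarith
    have hcomp : (t * Lam - 1) * (|⟪v, r k⟫| - τ * ‖r k‖) ≤ |⟪v, r (k + 1)⟫| := by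
      have h0 : ⟪v, r k - t • H (r k)⟫ = -((t * Lam - 1) * ⟪v, r k⟫) := by
        rw [inner_sub_right, real_inner_smul_right, ← hH.symm v (r k), hHv,
          real_inner_smul_left]
        ring
      have h1 : ⟪v, r (k + 1)⟫ = ⟪v, e⟫ - (t * Lam - 1) * ⟪v, r k⟫ := by
        rw [heq, inner_add_right, h0]
        ring
      have h2 := abs_sub_abs_le_abs_sub ((t * Lam - 1) * ⟪v, r k⟫) ⟪v, e⟫
      rw [abs_mul, abs_of_nonneg (by linarith : 0 ≤ t * Lam - 1), abs_sub_comm, ← h1] at h2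
      have h3 := abs_real_inner_le_norm v e
      rw [hv, one_mul] at h3
      linarith
    refine ⟨(t * Lam - 1) * G, one_le_mul_of_one_le_of_one_le hg1 hG1, ?_, ?_⟩
    · refine hnorm.trans ?_
      calc (t * Lam - 1) * ((1 + τ) * ‖r k‖)
          ≤ (t * Lam - 1) * ((1 + τ) * (G * ((1 + τ) ^ k * ‖r 0‖))) := by gcongr
        _ = (t * Lam - 1) * G * ((1 + τ) ^ (k + 1) * ‖r 0‖) := by ring
    · refine le_trans ?_ hcomp
      rw [mul_assoc]
      refine mul_le_mul_of_nonneg_left ?_ (by linarith)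
      have h1 := mul_le_mul_of_nonneg_left hGn hτ0
      have h2 : G * (|⟪v, r 0⟫| - ((1 + τ) ^ (k + 1) - 1) * ‖r 0‖)
          = G * (|⟪v, r 0⟫| - ((1 + τ) ^ k - 1) * ‖r 0‖)
            - τ * (G * ((1 + τ) ^ k * ‖r 0‖)) := by ring
      linarith

/-- An initial component of size `Δ` along a top eigenvector keeps the error above `Δ² / 4`
while `b_k` is below `η Lam / 2`, so `b` climbs to that level in at most `4 N` steps. -/
lemma le_climb_of_lt_max (h : NearlyLinear H η β ρ S r b) (hH : SpectralBounds H lam Lam)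
    (hη : 0 < η) (hβ : 0 < β) (hρ0 : 0 ≤ ρ) {v : E} (hv : ‖v‖ = 1) (hHv : H v = Lam • v)
    {Δ B N : ℝ} (hΔ : 0 < Δ) (hvr : Δ ≤ |⟪v, r 0⟫|) (hB : B = max (b 0) (η * Lam / 2))
    (hN : N = (B ^ 2 - b 0 ^ 2) / (β * Δ ^ 2))
    (hloss : 4 * (2 * ρ / Lam * (4 * N + 1)) * ‖r 0‖ ≤ Δ)
    (k : ℕ) (hb : b k < B) (hk : travel η b r k ≤ S) : (k : ℝ) ≤ 4 * N := by
  have hLam : 0 < Lam := hH.pos.trans_le hH.le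
  have hb0 := h.b_pos 0
  have hBm : b 0 ≤ B := hB ▸ le_max_left _ _
  have hN0 : 0 ≤ N := by
    rw [hN]
    have : b 0 ^ 2 ≤ B ^ 2 := by gcongr
    exact div_nonneg (by linarith) (by positivity)
  have hsmall : 2 * ρ / Lam * (4 * N + 1) ≤ 1 := by
    have h1 := hvr.trans (abs_real_inner_le_norm v (r 0))
    rw [hv, one_mul] at h1
    have h2 : 4 * (2 * ρ / Lam * (4 * N + 1)) ≤ 1 :=
      le_of_mul_le_mul_right (by linarith) (hΔ.trans_le h1)
    linarith
  have hbL : b k ≤ η * Lam / 2 := by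
    rcases lt_max_iff.mp (hB ▸ hb) with h1 | h1
    · exact absurd (h.b_mono hβ (Nat.zero_le k)) (not_le.mpr h1)
    · exact h1.le
  by_contra! hlt
  set J := ⌊4 * N⌋₊ + 1 with hJ
  have hJk : J ≤ k := (Nat.floor_lt (by positivity)).mpr hlt
  have hJN : (J : ℝ) ≤ 4 * N + 1 := by
    rw [hJ]
    push_cast
    linarith [Nat.floor_le (show 0 ≤ 4 * N by positivity)]
  have hJN' : 4 * N < J := by
    rw [hJ]
    push_cast
    exact Nat.lt_floor_add_one _
  have hbig : ∀ j < J, Δ ^ 2 / 4 ≤ ‖r j‖ ^ 2 := by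
    intro j hj
    obtain ⟨G, hG1, -, hGv⟩ := h.exists_amplification hH hη hβ hρ0 hv hHv j
      ((h.b_mono hβ (by omega)).trans hbL) ((h.travel_mono hη (by omega)).trans hk)
    set τ := 2 * ρ / Lam with hτ
    have hτ0 : 0 ≤ τ := by positivity
    have hτj : τ * j ≤ τ * (4 * N + 1) := by
      have : (j : ℝ) ≤ J := by exact_mod_cast hj.le
      gcongr
      linarith
    have hpow : (1 + τ) ^ j - 1 ≤ 2 * (τ * (4 * N + 1)) := by
      have h1 : (1 + τ) ^ j ≤ Real.exp (τ * j) := by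
        rw [mul_comm, Real.exp_nat_mul]
        have := Real.add_one_le_exp τ
        gcongr
        linarith
      have h0 : 0 ≤ τ * j := by positivity
      have h2 := Real.abs_exp_sub_one_le (x := τ * j) (by rw [abs_of_nonneg h0]; linarith)
      rw [abs_of_nonneg h0] at h2
      have h3 := (abs_le.mp h2).2
      linarith
    have h1 : Δ / 2 ≤ |⟪v, r 0⟫| - ((1 + τ) ^ j - 1) * ‖r 0‖ := by
      have := mul_le_mul_of_nonneg_right hpow (norm_nonneg (r 0))
      linarith
    have h2 : Δ / 2 ≤ |⟪v, r j⟫| := by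
      refine le_trans ?_ hGv
      nlinarith
    have h3 := abs_real_inner_le_norm v (r j)
    rw [hv, one_mul] at h3
    have h4 := pow_le_pow_left₀ (by positivity) (h2.trans h3) 2
    linarith
  have h1 : (J : ℝ) ≤ (B ^ 2 - b 0 ^ 2) / (β * (Δ ^ 2 / 4)) := by
    refine h.steps_le_climb hβ (by positivity) 0 J (fun j _ hj => hbig j (by omega)) ?_
    rw [zero_add]
    exact (h.b_mono hβ hJk).trans hb.le
  have h2 : (B ^ 2 - b 0 ^ 2) / (β * (Δ ^ 2 / 4)) = 4 * N := by
    rw [hN]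
    field_simp
  linarith

/-- The warm-up time when the initial residual has a component along a top eigenvector. -/
lemma le_two_stage_climb (h : NearlyLinear H η β ρ S r b) (hH : SpectralBounds H lam Lam)
    (hη : 0 < η) (hβ : 0 < β) (hρ0 : 0 ≤ ρ) {v : E} (hv : ‖v‖ = 1) (hHv : H v = Lam • v)
    {Δ B₁ N ε B : ℝ} (hΔ : 0 < Δ) (hvr : Δ ≤ |⟪v, r 0⟫|)
    (hB₁ : B₁ = max (b 0) (η * Lam / 2)) (hN : N = (B₁ ^ 2 - b 0 ^ 2) / (β * Δ ^ 2))
    (hloss : 4 * (2 * ρ / Lam * (4 * N + 1)) * ‖r 0‖ ≤ Δ)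
    (hε : 0 < ε) (hBB : B₁ ≤ B)
    (hS : √(η ^ 2 * ((B ^ 2 - b 0 ^ 2) / (β * ε)) * (2 / β * Real.log (B / b 0))) ≤ S)
    (k : ℕ) (hb : b k < B) (hr : ∀ j < k, ε < ‖r j‖ ^ 2) :
    (k : ℝ) ≤ 1 + 4 * N + (B ^ 2 - B₁ ^ 2) / (β * ε) := by
  have htr : travel η b r k ≤ S := (h.travel_le_of_lt hη hβ hε hb hr).trans hS
  have hb0 := h.b_pos 0
  have hB10 : b 0 ≤ B₁ := hB₁ ▸ le_max_left _ _
  have hN0 : 0 ≤ N := by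
    rw [hN]
    have : b 0 ^ 2 ≤ B₁ ^ 2 := by gcongr
    exact div_nonneg (by linarith) (by positivity)
  have hB10' : 0 ≤ B₁ := hb0.le.trans hB10
  have hc0 : 0 ≤ (B ^ 2 - B₁ ^ 2) / (β * ε) := by
    have : B₁ ^ 2 ≤ B ^ 2 := by gcongr
    exact div_nonneg (by linarith) (by positivity)
  have stage := h.le_climb_of_lt_max hH hη hβ hρ0 hv hHv hΔ hvr hB₁ hN hloss
  by_cases hbk : b k < B₁
  · have := stage k hbk htr
    linarith
  classical
  push Not at hbk
  have hpass : ∃ j, B₁ ≤ b j := ⟨k, hbk⟩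
  have hspec := Nat.find_spec hpass
  have hmin : Nat.find hpass ≤ k := Nat.find_min' hpass hbk
  have hfirst : (Nat.find hpass : ℝ) ≤ 4 * N + 1 := by
    rcases Nat.eq_zero_or_pos (Nat.find hpass) with h0 | h0
    · rw [h0]
      push_cast
      linarith
    · obtain ⟨s, hs⟩ := Nat.exists_eq_succ_of_ne_zero h0.ne'
      have h1 := stage s (not_le.mp (Nat.find_min hpass (by omega)))
        ((h.travel_mono hη (by omega)).trans htr)
      rw [hs]
      push_cast
      linarith
  set k₁ := Nat.find hpass
  obtain ⟨l, rfl⟩ := Nat.exists_eq_add_of_le hmin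
  have h1 := h.steps_le_climb hβ hε k₁ l (fun j _ hj => (hr j hj).le) hb.le
  have h2 : (B ^ 2 - b k₁ ^ 2) / (β * ε) ≤ (B ^ 2 - B₁ ^ 2) / (β * ε) := by
    gcongr
  push_cast
  linarith

end NearlyLinear
end WarmUp

/-! ### Training near the initialization -/

section Network

variable {d n m : ℕ}

/-- The derivative `𝟙{⟨w, x⟩ ≥ 0}` of the ReLU at the weight vector `w` and the input `x`. -/
def gate (x w : Vec d) : ℝ := Set.indicator {w : Vec d | 0 ≤ ⟪w, x⟫} (fun _ => 1) w

/-- Whether the activation of `w` on the input `x` can change when `w` moves by at most `R`. -/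
def nearGate (x : Vec d) (R : ℝ) (w : Vec d) : ℝ :=
  Set.indicator {w : Vec d | |⟪w, x⟫| ≤ R} (fun _ => 1) w

/-- The Gram matrix of the network with weights `W`, an empirical version of `gramInf`. -/
def empGram (x : Fin n → Vec d) (W : Weights d m) : Matrix (Fin n) (Fin n) ℝ :=
  Matrix.of fun i j => (∑ r, Set.indicator {w : Vec d | 0 ≤ ⟪w, x i⟫ ∧ 0 ≤ ⟪w, x j⟫}
    (fun _ => ⟪x i, x j⟫) (W r)) / m

/-- The fraction of neurons whose activation on the input `x` can change within distance `R`. -/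
def nearFraction (x : Vec d) (R : ℝ) (W : Weights d m) : ℝ := (∑ r, nearGate x R (W r)) / m

lemma gate_nonneg (x w : Vec d) : 0 ≤ gate x w :=
  Set.indicator_nonneg (fun _ _ => zero_le_one) _

lemma gate_le_one (x w : Vec d) : gate x w ≤ 1 :=
  Set.indicator_le' (fun _ _ => le_rfl) (fun _ _ => zero_le_one) _

lemma nearGate_nonneg (x : Vec d) (R : ℝ) (w : Vec d) : 0 ≤ nearGate x R w :=
  Set.indicator_nonneg (fun _ _ => zero_le_one) _

lemma nearFraction_nonneg (x : Vec d) (R : ℝ) (W : Weights d m) : 0 ≤ nearFraction x R W :=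
  div_nonneg (Finset.sum_nonneg fun _ _ => nearGate_nonneg _ _ _) (Nat.cast_nonneg _)

lemma gate_mul_gate (x x' w : Vec d) (c : ℝ) :
    Set.indicator {w : Vec d | 0 ≤ ⟪w, x⟫ ∧ 0 ≤ ⟪w, x'⟫} (fun _ => c) w
      = c * (gate x w * gate x' w) := by
  by_cases h1 : 0 ≤ ⟪w, x⟫ <;> by_cases h2 : 0 ≤ ⟪w, x'⟫ <;> simp [gate, Set.indicator, h1, h2]

lemma relu_eq_gate_mul (x w : Vec d) : relu ⟪w, x⟫ = gate x w * ⟪w, x⟫ := by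
  by_cases h1 : 0 ≤ ⟪w, x⟫
  · simp [relu, gate, h1]
  · simp [relu, gate, h1, (not_le.mp h1).le]

lemma abs_relu_sub_relu_le (a b : ℝ) : |relu a - relu b| ≤ |a - b| :=
  abs_max_sub_max_le_abs a b 0

lemma abs_inner_sub_le {x w w₀ : Vec d} (hx : ‖x‖ = 1) {R : ℝ} (hw : ‖w - w₀‖ ≤ R) :
    |⟪w, x⟫ - ⟪w₀, x⟫| ≤ R := by
  rw [← inner_sub_left]
  refine (abs_real_inner_le_norm _ _).trans ?_
  rwa [hx, mul_one]

lemma gate_eq_of_not_near {x w w₀ : Vec d} (hx : ‖x‖ = 1) {R : ℝ} (hw : ‖w - w₀‖ ≤ R)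
    (hR : R < |⟪w₀, x⟫|) : gate x w = gate x w₀ := by
  have h1 := abs_le.mp (abs_inner_sub_le hx hw)
  have h2 : 0 ≤ ⟪w, x⟫ ↔ 0 ≤ ⟪w₀, x⟫ := by
    rcases lt_abs.mp hR with h3 | h3
    · constructor <;> intro <;> linarith [norm_nonneg (w - w₀)]
    · constructor <;> intro <;> linarith [norm_nonneg (w - w₀)]
  simp [gate, Set.indicator, h2]

lemma abs_gate_sub_gate_le {x w w₀ : Vec d} (hx : ‖x‖ = 1) {R : ℝ} (hw : ‖w - w₀‖ ≤ R) :
    |gate x w - gate x w₀| ≤ nearGate x R w₀ := by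
  by_cases hR : |⟪w₀, x⟫| ≤ R
  · have h1 : nearGate x R w₀ = 1 := by simp [nearGate, hR]
    rw [h1, abs_le]
    constructor <;> linarith [gate_nonneg x w, gate_nonneg x w₀, gate_le_one x w,
      gate_le_one x w₀]
  · rw [gate_eq_of_not_near hx hw (not_le.mp hR), sub_self, abs_zero]
    exact nearGate_nonneg _ _ _

lemma lossGrad_eq (x : Fin n → Vec d) (y : Fin n → ℝ) (a : Fin m → ℝ) (W : Weights d m)
    (r : Fin m) :
    lossGrad x y a W r
      = -((1 / √(m : ℝ) * a r) • ∑ j, (residual x y a W j * gate (x j) (W r)) • x j) := by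
  rw [lossGrad, mul_smul, Finset.smul_sum (r := a r), ← smul_neg, ← Finset.sum_neg_distrib]
  congr 1
  refine Finset.sum_congr rfl fun j _ => ?_
  by_cases h1 : 0 ≤ ⟪W r, x j⟫
  · simp [gate, h1, smul_smul, mul_comm]
  · simp [gate, h1]

lemma norm_lossGrad_le {x : Fin n → Vec d} (hx : ∀ i, ‖x i‖ = 1) (y : Fin n → ℝ)
    {a : Fin m → ℝ} (ha : ∀ r, |a r| = 1) (W : Weights d m) (r : Fin m) :
    ‖lossGrad x y a W r‖ ≤ 1 / √(m : ℝ) * ∑ j, |residual x y a W j| := by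
  rw [lossGrad_eq, norm_neg, norm_smul, Real.norm_eq_abs, abs_mul, ha, mul_one,
    abs_of_nonneg (by positivity)]
  refine mul_le_mul_of_nonneg_left ?_ (by positivity)
  refine (norm_sum_le _ _).trans (Finset.sum_le_sum fun j _ => ?_)
  rw [norm_smul, hx, mul_one, Real.norm_eq_abs, abs_mul, abs_of_nonneg (gate_nonneg _ _)]
  exact mul_le_of_le_one_right (abs_nonneg _) (gate_le_one _ _)

/-- The contribution of one neuron to the change of the network in a gradient step, compared with
its contribution to `t · empGram`. Only neurons near an activation boundary contribute an error. -/
lemma abs_neuron_step_sub_le {x : Fin n → Vec d} (hx : ∀ i, ‖x i‖ = 1) (ρ : Fin n → ℝ)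
    {a : ℝ} (ha : |a| = 1) {R s : ℝ} (hs : 0 ≤ s) {w w' w₀ : Vec d} (hw : ‖w - w₀‖ ≤ R)
    (hw' : ‖w' - w₀‖ ≤ R) (hstep : w' - w = (s * a) • ∑ j, (ρ j * gate (x j) w) • x j)
    (i : Fin n) :
    |a * (relu ⟪w', x i⟫ - relu ⟪w, x i⟫)
        - s * ∑ j, ρ j * (⟪x i, x j⟫ * (gate (x i) w₀ * gate (x j) w₀))|
      ≤ s * ∑ j, |ρ j| * (nearGate (x j) R w₀ + 2 * nearGate (x i) R w₀) := by
  have haa : a * a = 1 := by rw [← abs_mul_abs_self, ha, one_mul]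
  have hin : ∀ j, |⟪x i, x j⟫| ≤ 1 := fun j => by
    simpa [hx] using abs_real_inner_le_norm (x i) (x j)
  have hD : ⟪w', x i⟫ - ⟪w, x i⟫ = s * a * ∑ j, ρ j * gate (x j) w * ⟪x i, x j⟫ := by
    rw [← inner_sub_left, hstep, real_inner_smul_left, sum_inner]
    congr 1
    refine Finset.sum_congr rfl fun j _ => ?_
    rw [real_inner_smul_left, real_inner_comm]
  by_cases hR : |⟪w₀, x i⟫| ≤ R
  · have h1 : nearGate (x i) R w₀ = 1 := by simp [nearGate, hR]
    have h2 : |a * (relu ⟪w', x i⟫ - relu ⟪w, x i⟫)| ≤ s * ∑ j, |ρ j| := by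
      rw [abs_mul, ha, one_mul]
      refine (abs_relu_sub_relu_le _ _).trans ?_
      rw [hD, abs_mul, abs_mul, ha, mul_one, abs_of_nonneg hs]
      refine mul_le_mul_of_nonneg_left ?_ hs
      refine (Finset.abs_sum_le_sum_abs _ _).trans (Finset.sum_le_sum fun j _ => ?_)
      rw [abs_mul, abs_mul, abs_of_nonneg (gate_nonneg _ _), mul_assoc]
      exact mul_le_of_le_one_right (abs_nonneg _)
        (mul_le_one₀ (gate_le_one _ _) (abs_nonneg _) (hin j))
    have h3 : |s * ∑ j, ρ j * (⟪x i, x j⟫ * (gate (x i) w₀ * gate (x j) w₀))|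
        ≤ s * ∑ j, |ρ j| := by
      rw [abs_mul, abs_of_nonneg hs]
      refine mul_le_mul_of_nonneg_left ?_ hs
      refine (Finset.abs_sum_le_sum_abs _ _).trans (Finset.sum_le_sum fun j _ => ?_)
      have hg : 0 ≤ gate (x i) w₀ * gate (x j) w₀ := mul_nonneg (gate_nonneg _ _) (gate_nonneg _ _)
      rw [abs_mul, abs_mul, abs_of_nonneg hg]
      exact mul_le_of_le_one_right (abs_nonneg _) (mul_le_one₀ (hin j) hg
        (mul_le_one₀ (gate_le_one _ _) (gate_nonneg _ _) (gate_le_one _ _)))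
    have h4 : s * ∑ j, |ρ j| + s * ∑ j, |ρ j|
        ≤ s * ∑ j, |ρ j| * (nearGate (x j) R w₀ + 2 * nearGate (x i) R w₀) := by
      rw [← mul_add, ← Finset.sum_add_distrib]
      refine mul_le_mul_of_nonneg_left (Finset.sum_le_sum fun j _ => ?_) hs
      rw [h1]
      nlinarith [abs_nonneg (ρ j), nearGate_nonneg (x j) R w₀]
    exact (abs_sub _ _).trans ((add_le_add h2 h3).trans h4)
  · have hg := gate_eq_of_not_near (hx i) hw (not_le.mp hR)
    have hg' := gate_eq_of_not_near (hx i) hw' (not_le.mp hR)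
    have h1 : a * (relu ⟪w', x i⟫ - relu ⟪w, x i⟫)
          - s * ∑ j, ρ j * (⟪x i, x j⟫ * (gate (x i) w₀ * gate (x j) w₀))
        = s * ∑ j, ρ j * (gate (x i) w₀ * ⟪x i, x j⟫ * (gate (x j) w - gate (x j) w₀)) := by
      rw [relu_eq_gate_mul, relu_eq_gate_mul, hg, hg', ← mul_sub, hD]
      have h2 : a * (gate (x i) w₀ * (s * a * ∑ j, ρ j * gate (x j) w * ⟪x i, x j⟫))
          = s * ∑ j, ρ j * gate (x j) w * ⟪x i, x j⟫ * gate (x i) w₀ := by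
        rw [← Finset.sum_mul]
        linear_combination (s * gate (x i) w₀ * ∑ j, ρ j * gate (x j) w * ⟪x i, x j⟫) * haa
      rw [h2, ← mul_sub, ← Finset.sum_sub_distrib]
      congr 1
      refine Finset.sum_congr rfl fun j _ => ?_
      ring
    rw [h1, abs_mul, abs_of_nonneg hs]
    refine mul_le_mul_of_nonneg_left ?_ hs
    refine (Finset.abs_sum_le_sum_abs _ _).trans (Finset.sum_le_sum fun j _ => ?_)
    rw [abs_mul, abs_mul, abs_mul, abs_of_nonneg (gate_nonneg _ _)]
    refine mul_le_mul_of_nonneg_left ?_ (abs_nonneg _)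
    have h2 := abs_gate_sub_gate_le (hx j) hw
    have h3 := nearGate_nonneg (x i) R w₀
    calc gate (x i) w₀ * |⟪x i, x j⟫| * |gate (x j) w - gate (x j) w₀|
        ≤ 1 * nearGate (x j) R w₀ := by
          gcongr
          exact mul_le_one₀ (gate_le_one _ _) (abs_nonneg _) (hin j)
      _ ≤ _ := by linarith

/-- A gradient step of length `t` near the initialization changes the outputs by
`t · empGram *ᵥ residual`, up to an error controlled by the neurons near an activation boundary. -/
lemma abs_network_step_sub_le {x : Fin n → Vec d} (hx : ∀ i, ‖x i‖ = 1) (y : Fin n → ℝ)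
    {a : Fin m → ℝ} (ha : ∀ r, |a r| = 1) {R t : ℝ} (ht : 0 ≤ t) {W W' W₀ : Weights d m}
    (hW : ∀ r, ‖W r - W₀ r‖ ≤ R) (hW' : ∀ r, ‖W' r - W₀ r‖ ≤ R)
    (hstep : ∀ r, W' r = W r - t • lossGrad x y a W r) (i : Fin n) :
    |network W' a (x i) - network W a (x i)
        - t * (empGram x W₀).mulVec (residual x y a W) i|
      ≤ t * ∑ j, |residual x y a W j|
          * (nearFraction (x j) R W₀ + 2 * nearFraction (x i) R W₀) := by
  set ρ := residual x y a W with hρ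
  set q := 1 / √(m : ℝ) with hq
  have hq0 : 0 ≤ q := by positivity
  have hqq : q * q = 1 / m := by
    rw [hq, div_mul_div_comm, Real.mul_self_sqrt (Nat.cast_nonneg _), one_mul]
  have key : ∀ r, |a r * (relu ⟪W' r, x i⟫ - relu ⟪W r, x i⟫)
        - t * q * ∑ j, ρ j * (⟪x i, x j⟫ * (gate (x i) (W₀ r) * gate (x j) (W₀ r)))|
      ≤ t * q * ∑ j, |ρ j| * (nearGate (x j) R (W₀ r) + 2 * nearGate (x i) R (W₀ r)) := by
    intro r
    refine abs_neuron_step_sub_le hx ρ (ha r) (mul_nonneg ht hq0) (hW r) (hW' r) ?_ i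
    rw [hstep, lossGrad_eq, ← hρ, ← hq, smul_neg, sub_neg_eq_add, add_sub_cancel_left, smul_smul,
      mul_assoc]
  have h1 : network W' a (x i) - network W a (x i) - t * (empGram x W₀).mulVec ρ i
      = q * ∑ r, (a r * (relu ⟪W' r, x i⟫ - relu ⟪W r, x i⟫)
        - t * q * ∑ j, ρ j * (⟪x i, x j⟫ * (gate (x i) (W₀ r) * gate (x j) (W₀ r)))) := by
    have h2 : t * (empGram x W₀).mulVec ρ i = q * ∑ r, t * q *
        ∑ j, ρ j * (⟪x i, x j⟫ * (gate (x i) (W₀ r) * gate (x j) (W₀ r))) := by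
      rw [← Finset.mul_sum, Finset.sum_comm, ← mul_assoc, mul_left_comm, hqq, mul_assoc]
      congr 1
      simp only [Matrix.mulVec, dotProduct, empGram, Matrix.of_apply, gate_mul_gate]
      rw [Finset.mul_sum]
      refine Finset.sum_congr rfl fun j _ => ?_
      simp only [← Finset.mul_sum]
      ring
    rw [h2, Finset.sum_sub_distrib, mul_sub]
    simp only [network, mul_sub, Finset.sum_sub_distrib, hq]
  rw [h1, abs_mul, abs_of_nonneg hq0]
  calc q * |∑ r, (a r * (relu ⟪W' r, x i⟫ - relu ⟪W r, x i⟫)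
        - t * q * ∑ j, ρ j * (⟪x i, x j⟫ * (gate (x i) (W₀ r) * gate (x j) (W₀ r))))|
      ≤ q * ∑ r, t * q *
          ∑ j, |ρ j| * (nearGate (x j) R (W₀ r) + 2 * nearGate (x i) R (W₀ r)) := by
        gcongr
        exact (Finset.abs_sum_le_sum_abs _ _).trans (Finset.sum_le_sum fun r _ => key r)
    _ = t * ∑ j, |ρ j| * (nearFraction (x j) R W₀ + 2 * nearFraction (x i) R W₀) := by
        rw [← Finset.mul_sum, Finset.sum_comm, ← mul_assoc, mul_left_comm, hqq, mul_assoc]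
        congr 1
        rw [Finset.mul_sum]
        refine Finset.sum_congr rfl fun j _ => ?_
        rw [← Finset.mul_sum, Finset.sum_add_distrib, ← Finset.mul_sum, nearFraction,
          nearFraction]
        ring

/-- The residual vector as an element of Euclidean space. -/
def resVec (x : Fin n → Vec d) (y : Fin n → ℝ) (a : Fin m → ℝ) (W : Weights d m) :
    EuclideanSpace ℝ (Fin n) := WithLp.toLp 2 (residual x y a W)

lemma sq_norm_resVec (x : Fin n → Vec d) (y : Fin n → ℝ) (a : Fin m → ℝ) (W : Weights d m) :
    ‖resVec x y a W‖ ^ 2 = sqError x y a W := by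
  rw [EuclideanSpace.real_norm_sq_eq]
  rfl

lemma norm_le_sum_abs (z : EuclideanSpace ℝ (Fin n)) : ‖z‖ ≤ ∑ i, |z i| := by
  conv_lhs => rw [← (EuclideanSpace.basisFun (Fin n) ℝ).sum_repr z]
  refine (norm_sum_le _ _).trans (Finset.sum_le_sum fun i _ => ?_)
  simp [norm_smul]

lemma sum_abs_le_mul_norm (z : EuclideanSpace ℝ (Fin n)) : ∑ i, |z i| ≤ n * ‖z‖ := by
  calc ∑ i, |z i| ≤ ∑ _i : Fin n, ‖z‖ := Finset.sum_le_sum fun i _ => PiLp.norm_apply_le z i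
    _ = n * ‖z‖ := by simp

/-- The operator norm is bounded by the Frobenius norm. -/
lemma norm_toEuclideanLin_le (A : Matrix (Fin n) (Fin n) ℝ) (z : EuclideanSpace ℝ (Fin n)) :
    ‖Matrix.toEuclideanLin A z‖ ≤ √(∑ i, ∑ j, A i j ^ 2) * ‖z‖ := by
  refine le_of_sq_le_sq ?_ (by positivity)
  rw [mul_pow, Real.sq_sqrt (by positivity), EuclideanSpace.real_norm_sq_eq,
    EuclideanSpace.real_norm_sq_eq, Finset.sum_mul]
  refine Finset.sum_le_sum fun i _ => ?_
  exact Finset.sum_mul_sq_le_sq_mul_sq Finset.univ (A i) z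

lemma nearlyLinear_step {x : Fin n → Vec d} (hx : ∀ i, ‖x i‖ = 1) (y : Fin n → ℝ)
    {a : Fin m → ℝ} (ha : ∀ r, |a r| = 1) {R t σ γ : ℝ} (ht : 0 ≤ t) {W W' W₀ : Weights d m}
    (hW : ∀ r, ‖W r - W₀ r‖ ≤ R) (hW' : ∀ r, ‖W' r - W₀ r‖ ≤ R)
    (hstep : ∀ r, W' r = W r - t • lossGrad x y a W r)
    (hσ : ∑ i, nearFraction (x i) R W₀ ≤ σ)
    (hγ : ∑ i, ∑ j, (empGram x W₀ i j - gramInf x i j) ^ 2 ≤ γ ^ 2) (hγ0 : 0 ≤ γ) :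
    ‖resVec x y a W' - (resVec x y a W
        - t • Matrix.toEuclideanLin (gramInf x) (resVec x y a W))‖
      ≤ t * ((3 * n * σ + γ) * ‖resVec x y a W‖) := by
  set z := resVec x y a W with hz
  set e : EuclideanSpace ℝ (Fin n) := WithLp.toLp 2 fun i =>
    network W' a (x i) - network W a (x i)
      - t * (empGram x W₀).mulVec (residual x y a W) i with he
  have hsplit : resVec x y a W' - (z - t • Matrix.toEuclideanLin (gramInf x) z)
      = -(e + t • Matrix.toEuclideanLin (empGram x W₀ - gramInf x) z) := by
    ext i
    simp [hz, he, resVec, residual]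
    ring
  have hσ0 : ∀ i, 0 ≤ nearFraction (x i) R W₀ := fun i => nearFraction_nonneg _ _ _
  have hei : ∀ i, |e i| ≤ t * (‖z‖ * σ + 2 * nearFraction (x i) R W₀ * (n * ‖z‖)) := by
    intro i
    refine (abs_network_step_sub_le hx y ha ht hW hW' hstep i).trans ?_
    refine mul_le_mul_of_nonneg_left ?_ ht
    simp only [mul_add, Finset.sum_add_distrib]
    refine add_le_add ?_ ?_
    · calc ∑ j, |residual x y a W j| * nearFraction (x j) R W₀
          ≤ ∑ j, ‖z‖ * nearFraction (x j) R W₀ := by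
            refine Finset.sum_le_sum fun j _ => ?_
            exact mul_le_mul_of_nonneg_right (PiLp.norm_apply_le z j) (hσ0 j)
        _ = ‖z‖ * ∑ j, nearFraction (x j) R W₀ := by rw [Finset.mul_sum]
        _ ≤ _ := by gcongr
    · rw [← Finset.sum_mul, mul_comm]
      exact mul_le_mul_of_nonneg_left (sum_abs_le_mul_norm z)
        (mul_nonneg zero_le_two (hσ0 i))
  have henorm : ‖e‖ ≤ t * (3 * n * σ * ‖z‖) := by
    refine (norm_le_sum_abs e).trans ((Finset.sum_le_sum fun i _ => hei i).trans ?_)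
    rw [← Finset.mul_sum, Finset.sum_add_distrib, ← Finset.sum_mul, ← Finset.sum_mul,
      ← Finset.mul_sum]
    refine mul_le_mul_of_nonneg_left ?_ ht
    have h1 := mul_le_mul_of_nonneg_right hσ (show 0 ≤ n * ‖z‖ by positivity)
    simp only [Finset.sum_const, Finset.card_univ, Fintype.card_fin, nsmul_eq_mul]
    linarith
  have hop : ‖t • Matrix.toEuclideanLin (empGram x W₀ - gramInf x) z‖ ≤ t * (γ * ‖z‖) := by
    rw [norm_smul, Real.norm_of_nonneg ht]
    refine mul_le_mul_of_nonneg_left ((norm_toEuclideanLin_le _ z).trans ?_) ht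
    gcongr
    exact (Real.sqrt_le_left hγ0).mpr (by simpa using hγ)
  rw [hsplit, norm_neg]
  refine (norm_add_le _ _).trans ?_
  linarith

/-- If few neurons lie near an activation boundary and the empirical Gram matrix is close to its
limit, then AdaLoss is nearly linear for as long as no weight has moved by more than `R`. -/
theorem nearlyLinear_of_init {x : Fin n → Vec d} (hx : ∀ i, ‖x i‖ = 1) (y : Fin n → ℝ)
    (hm : 0 < m) (hn : 0 < n) {b₀ η α : ℝ} (hb₀ : 0 < b₀) (hη : 0 < η)
    {a : Fin m → ℝ} (ha : ∀ r, |a r| = 1) {R σ γ : ℝ} {W₀ : Weights d m}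
    (hσ : ∑ i, nearFraction (x i) R W₀ ≤ σ)
    (hγ : ∑ i, ∑ j, (empGram x W₀ i j - gramInf x i j) ^ 2 ≤ γ ^ 2) (hγ0 : 0 ≤ γ) :
    NearlyLinear (Matrix.toEuclideanLin (gramInf x)) η (α ^ 2 * √(n : ℝ)) (3 * n * σ + γ)
      (R * √(m : ℝ) / n)
      (fun k => resVec x y a (iterate x y b₀ η α a W₀ k).1)
      (fun k => (iterate x y b₀ η α a W₀ k).2) := by
  set s := iterate x y b₀ η α a W₀ with hs
  have hsucc : ∀ k, s (k + 1) = step x y η α a (s k) := fun k => by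
    rw [hs, iterate, iterate, Function.iterate_succ_apply']
  have herr : ∀ W : Weights d m, 0 ≤ sqError x y a W := fun W =>
    Finset.sum_nonneg fun _ _ => sq_nonneg _
  have hbsq : ∀ k, (s (k + 1)).2 ^ 2
      = (s k).2 ^ 2 + α ^ 2 * √(n : ℝ) * ‖resVec x y a (s k).1‖ ^ 2 := by
    intro k
    rw [hsucc, sq_norm_resVec]
    have := herr (s k).1
    exact Real.sq_sqrt (by positivity)
  have hbpos : ∀ k, 0 < (s k).2 := by
    intro k
    induction k with
    | zero => exact hb₀
    | succ k ih =>
      rw [hsucc]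
      have := herr (s k).1
      exact Real.sqrt_pos.mpr (by positivity)
  have hWsucc : ∀ k r, (s (k + 1)).1 r
      = (s k).1 r - (η / (s (k + 1)).2) • lossGrad x y a (s k).1 r := by
    intro k r
    rw [hsucc]
    rfl
  have hmR : (0 : ℝ) < √(m : ℝ) := Real.sqrt_pos.mpr (by exact_mod_cast hm)
  have hnR : (0 : ℝ) < n := by exact_mod_cast hn
  have hmove : ∀ k r, ‖(s k).1 r - W₀ r‖
      ≤ n / √(m : ℝ) * travel η (fun k => (s k).2) (fun k => resVec x y a (s k).1) k := by
    intro k r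
    induction k with
    | zero => simp [travel, hs, iterate]
    | succ k ih =>
      have ht : 0 < η / (s (k + 1)).2 := div_pos hη (hbpos _)
      have h1 : ‖lossGrad x y a (s k).1 r‖ ≤ n / √(m : ℝ) * ‖resVec x y a (s k).1‖ := by
        refine (norm_lossGrad_le hx y ha _ r).trans ?_
        have := mul_le_mul_of_nonneg_left (sum_abs_le_mul_norm (resVec x y a (s k).1))
          (show 0 ≤ 1 / √(m : ℝ) by positivity)
        refine this.trans (le_of_eq ?_)
        ring
      rw [travel_succ, hWsucc, sub_right_comm]
      refine (norm_sub_le _ _).trans ?_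
      rw [norm_smul, Real.norm_of_nonneg ht.le]
      have h2 := mul_le_mul_of_nonneg_left h1 ht.le
      linarith
  refine ⟨hbpos, hbsq, fun k hk => ?_⟩
  have hR : n / √(m : ℝ) * (R * √(m : ℝ) / n) = R := by field_simp
  have hdom : ∀ j, travel η (fun k => (s k).2) (fun k => resVec x y a (s k).1) j
      ≤ R * √(m : ℝ) / n → ∀ r, ‖(s j).1 r - W₀ r‖ ≤ R := by
    intro j hj r
    refine (hmove j r).trans ?_
    have := mul_le_mul_of_nonneg_left hj (show 0 ≤ n / √(m : ℝ) by positivity)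
    rwa [hR] at this
  have ht : 0 < η / (s (k + 1)).2 := div_pos hη (hbpos _)
  refine nearlyLinear_step hx y ha ht.le (hdom k (le_trans ?_ hk)) (hdom (k + 1) hk)
    (hWsucc k) hσ hγ hγ0
  rw [travel_succ]
  have : 0 ≤ η / (s (k + 1)).2 * ‖resVec x y a (s k).1‖ := by positivity
  linarith

end Network

/-! ### The random initialization -/

section Init

variable {d n m : ℕ}

/-- The uniform law on `{-1, 1}`, from which the output weights are drawn. -/
abbrev signLaw : Measure ℝ := uniformOn ({-1, 1} : Set ℝ)

instance : IsProbabilityMeasure signLaw :=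
  isProbabilityMeasure_uniformOn (Set.toFinite _) ⟨-1, by simp⟩

instance : IsProbabilityMeasure (initLaw d m) := by
  unfold initLaw
  infer_instance

lemma ae_abs_eq_one_signLaw : ∀ᵐ a ∂signLaw, |a| = 1 := by
  have h : uniformOn ({-1, 1} : Set ℝ) {a | |a| = 1}ᶜ = 0 := by
    rw [uniformOn_eq_zero_iff (Set.toFinite _)]
    ext a
    simp only [Set.mem_inter_iff, Set.mem_insert_iff, Set.mem_singleton_iff, Set.mem_compl_iff,
      Set.mem_ofPred_eq, Set.mem_empty_iff_false, iff_false, not_and, not_not]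
    rintro (rfl | rfl) <;> simp
  exact h

lemma integral_id_signLaw : ∫ a, a ∂signLaw = 0 := by
  have hs : ({-1, 1} : Set ℝ) = (({-1, 1} : Finset ℝ) : Set ℝ) := by simp
  rw [signLaw, uniformOn, ProbabilityTheory.cond, integral_smul_measure, hs, setIntegral_finset]
  · rw [Finset.sum_pair (by norm_num)]
    simp [Measure.real]
  · rw [← hs]
    have hfin : ({-1, 1} : Set ℝ).Finite := Set.toFinite _
    refine IntegrableOn.of_bound (Measure.count_apply_lt_top.mpr hfin)
      measurable_id.aestronglyMeasurable 1 (ae_restrict_of_forall_mem hfin.measurableSet ?_)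
    rintro a (rfl | rfl) <;> simp

/-- The law of the hidden and output weights of one neuron. -/
abbrev neuronLaw (d : ℕ) : Measure (Vec d × ℝ) := (stdGaussian (Vec d)).prod signLaw

lemma integral_sq_sum_eq {f : Vec d × ℝ → ℝ} (hf : MemLp f 2 (neuronLaw d))
    (h0 : ∫ p, f p ∂(neuronLaw d) = 0) :
    ∫ ω, (∑ r, f (ω r)) ^ 2 ∂(initLaw d m) = m * ∫ p, f p ^ 2 ∂(neuronLaw d) := by
  have hint : ∀ r : Fin m, Integrable (fun ω : Fin m → Vec d × ℝ => f (ω r)) (initLaw d m) :=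
    fun r => integrable_comp_eval (hf.integrable one_le_two)
  have h1 := variance_sum_pi (ι := Fin m) (μ := fun _ => neuronLaw d) (X := fun _ => f)
    fun _ => hf
  rw [variance_of_integral_eq_zero, variance_of_integral_eq_zero hf.aemeasurable h0] at h1
  · simpa [initLaw] using h1
  · exact (Finset.aemeasurable_sum _ fun r _ => (hint r).aemeasurable)
  · simp only [Finset.sum_apply]
    refine (integral_finsetSum _ fun r _ => hint r).trans (Finset.sum_eq_zero fun r _ => ?_)
    exact (integral_comp_eval hf.aestronglyMeasurable).trans h0

lemma integrable_sq_sum {f : Vec d × ℝ → ℝ} (hf : MemLp f 2 (neuronLaw d)) :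
    Integrable (fun ω : Fin m → Vec d × ℝ => (∑ r, f (ω r)) ^ 2) (initLaw d m) := by
  refine MemLp.integrable_sq ?_
  exact memLp_finsetSum _ fun r _ => hf.comp_measurePreserving (measurePreserving_eval _ r)

lemma map_inner_stdGaussian {x : Vec d} (hx : ‖x‖ = 1) :
    (stdGaussian (Vec d)).map (fun w => ⟪w, x⟫) = gaussianReal 0 1 := by
  have h := IsGaussian.map_eq_gaussianReal (μ := stdGaussian (Vec d)) (innerSL ℝ x)
  rw [integral_strongDual_stdGaussian, variance_dual_stdGaussian, innerSL_apply_norm, hx] at h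
  simpa [real_inner_comm] using h

lemma memLp_inner_stdGaussian (x : Vec d) :
    MemLp (fun w => ⟪w, x⟫) 2 (stdGaussian (Vec d)) := by
  have h := IsGaussian.memLp_dual (stdGaussian (Vec d)) (innerSL ℝ x) 2 (by simp)
  simpa [real_inner_comm] using h

lemma integral_sq_inner_stdGaussian {x : Vec d} (hx : ‖x‖ = 1) :
    ∫ w, ⟪w, x⟫ ^ 2 ∂(stdGaussian (Vec d)) = 1 := by
  have h := variance_dual_stdGaussian (innerSL ℝ x)
  rw [variance_of_integral_eq_zero (by fun_prop) (integral_strongDual_stdGaussian _),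
    innerSL_apply_norm, hx] at h
  simpa [real_inner_comm] using h

/-- Anti-concentration: the standard Gaussian density is at most `1 / 2`. -/
lemma integral_nearGate_le {x : Vec d} (hx : ‖x‖ = 1) {R : ℝ} (hR : 0 ≤ R) :
    ∫ w, nearGate x R w ∂(stdGaussian (Vec d)) ≤ R := by
  have hset : {w : Vec d | |⟪w, x⟫| ≤ R} = (fun w => ⟪w, x⟫) ⁻¹' Set.Icc (-R) R := by
    ext w
    simp [abs_le]
  have hmeas : Measurable fun w : Vec d => ⟪w, x⟫ := by fun_prop
  have h1 : ∫ w, nearGate x R w ∂(stdGaussian (Vec d))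
      = (gaussianReal 0 1).real (Set.Icc (-R) R) := by
    simp only [nearGate]
    rw [integral_indicator_const _ (by rw [hset]; exact hmeas measurableSet_Icc), hset,
      smul_eq_mul, mul_one, ← map_inner_stdGaussian hx, Measure.real, Measure.real,
      Measure.map_apply hmeas measurableSet_Icc]
  have h2 : ∀ z : ℝ, gaussianPDFReal 0 1 z ≤ 1 / 2 := by
    intro z
    rw [gaussianPDFReal_def]
    have hpi : 2 ≤ √(2 * Real.pi * ((1 : NNReal) : ℝ)) := by
      refine Real.le_sqrt_of_sq_le ?_
      push_cast
      linarith [Real.pi_gt_three]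
    have hexp : Real.exp (-(z - 0) ^ 2 / (2 * ((1 : NNReal) : ℝ))) ≤ 1 := by
      rw [Real.exp_le_one_iff]
      push_cast
      nlinarith [sq_nonneg (z - 0)]
    calc _ ≤ (2 : ℝ)⁻¹ * 1 :=
          mul_le_mul (inv_anti₀ two_pos hpi) hexp (Real.exp_pos _).le (by norm_num)
      _ = 1 / 2 := by norm_num
  rw [h1, Measure.real, gaussianReal_apply_eq_integral _ one_ne_zero, ENNReal.toReal_ofReal
    (integral_nonneg fun z => gaussianPDFReal_nonneg _ _ _)]
  calc ∫ z in Set.Icc (-R) R, gaussianPDFReal 0 1 z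
      ≤ ∫ _z in Set.Icc (-R) R, (1 / 2 : ℝ) := by
        refine setIntegral_mono (integrable_gaussianPDFReal _ _).integrableOn ?_ h2
        exact integrableOn_const (by simp)
    _ = R := by
        rw [setIntegral_const, Measure.real, Real.volume_Icc, ENNReal.toReal_ofReal (by linarith),
          smul_eq_mul]
        ring

lemma measurable_nearGate (x : Vec d) (R : ℝ) : Measurable (nearGate x R) := by
  refine measurable_const.indicator (measurableSet_le ?_ measurable_const)
  fun_prop

lemma measurable_gramEntry (x x' : Vec d) (c : ℝ) :
    Measurable (Set.indicator {w : Vec d | 0 ≤ ⟪w, x⟫ ∧ 0 ≤ ⟪w, x'⟫} (fun _ => c)) := by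
  refine measurable_const.indicator (MeasurableSet.inter ?_ ?_)
  · exact measurableSet_le (g := fun w : Vec d => ⟪w, x⟫) measurable_const (by fun_prop)
  · exact measurableSet_le (g := fun w : Vec d => ⟪w, x'⟫) measurable_const (by fun_prop)

lemma integrable_nearGate_eval (x : Vec d) (R : ℝ) (r : Fin m) :
    Integrable (fun ω : Fin m → Vec d × ℝ => nearGate x R (ω r).1) (initLaw d m) := by
  refine integrable_comp_eval (f := fun p : Vec d × ℝ => nearGate x R p.1)
    (μ := fun _ => neuronLaw d) (i := r) ?_
  refine Integrable.of_bound ((measurable_nearGate _ _).comp measurable_fst).aestronglyMeasurable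
    1 (Filter.Eventually.of_forall fun p => ?_)
  rw [Real.norm_of_nonneg (nearGate_nonneg _ _ _)]
  exact Set.indicator_le' (fun _ _ => le_rfl) (fun _ _ => zero_le_one) _

lemma integrable_sum_nearFraction (x : Fin n → Vec d) (R : ℝ) :
    Integrable (fun ω : Fin m → Vec d × ℝ => ∑ i, nearFraction (x i) R fun r => (ω r).1)
      (initLaw d m) := by
  exact integrable_finsetSum _ fun i _ =>
    (integrable_finsetSum _ fun r _ => integrable_nearGate_eval (x i) R r).div_const _

lemma integral_sum_nearFraction_le (hm : 0 < m) {x : Fin n → Vec d} (hx : ∀ i, ‖x i‖ = 1)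
    {R : ℝ} (hR : 0 ≤ R) :
    ∫ ω, ∑ i, nearFraction (x i) R (fun r => (ω r).1) ∂(initLaw d m) ≤ n * R := by
  have hmeas : ∀ i, Measurable fun p : Vec d × ℝ => nearGate (x i) R p.1 := fun i =>
    (measurable_nearGate _ _).comp measurable_fst
  have hint := fun i (r : Fin m) => integrable_nearGate_eval (x i) R r
  have hmR : (0 : ℝ) < m := by exact_mod_cast hm
  have hone : ∀ i (r : Fin m), ∫ ω, nearGate (x i) R (ω r).1 ∂(initLaw d m) ≤ R := by
    intro i r
    refine le_trans (le_of_eq ?_) (integral_nearGate_le (hx i) hR)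
    refine (integral_comp_eval (f := fun p : Vec d × ℝ => nearGate (x i) R p.1)
      (μ := fun _ => neuronLaw d) (i := r) (hmeas i).aestronglyMeasurable).trans ?_
    rw [integral_fun_fst (fun w => nearGate (x i) R w)]
    simp
  unfold nearFraction
  rw [integral_finsetSum _ fun i _ => (integrable_finsetSum _ fun r _ => hint i r).div_const _]
  calc ∑ i, ∫ ω, (∑ r, nearGate (x i) R (ω r).1) / (m : ℝ) ∂(initLaw d m)
      ≤ ∑ _i : Fin n, R := by
        refine Finset.sum_le_sum fun i _ => ?_
        rw [integral_div, integral_finsetSum _ fun r _ => hint i r, div_le_iff₀ hmR]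
        refine (Finset.sum_le_sum fun r _ => hone i r).trans (le_of_eq ?_)
        simp [mul_comm]
    _ = n * R := by simp

/-- The centred contribution of one neuron to an entry of `empGram`. -/
def gramDev (x : Fin n → Vec d) (i j : Fin n) (p : Vec d × ℝ) : ℝ :=
  Set.indicator {w : Vec d | 0 ≤ ⟪w, x i⟫ ∧ 0 ≤ ⟪w, x j⟫} (fun _ => ⟪x i, x j⟫) p.1
    - gramInf x i j

lemma memLp_gramEntry (x : Fin n → Vec d) (i j : Fin n) :
    MemLp (Set.indicator {w : Vec d | 0 ≤ ⟪w, x i⟫ ∧ 0 ≤ ⟪w, x j⟫} (fun _ => ⟪x i, x j⟫)) 2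
      (stdGaussian (Vec d)) := by
  refine MemLp.of_bound (measurable_gramEntry _ _ _).aestronglyMeasurable |⟪x i, x j⟫|
    (Filter.Eventually.of_forall fun w => ?_)
  exact (norm_indicator_le_norm_self (fun _ => ⟪x i, x j⟫) w)

lemma memLp_gramDev (x : Fin n → Vec d) (i j : Fin n) : MemLp (gramDev x i j) 2 (neuronLaw d) :=
  ((memLp_gramEntry x i j).comp_fst _).sub (memLp_const _)

lemma integral_gramDev (x : Fin n → Vec d) (i j : Fin n) :
    ∫ p, gramDev x i j p ∂(neuronLaw d) = 0 := by
  unfold gramDev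
  rw [integral_sub (((memLp_gramEntry x i j).comp_fst _).integrable one_le_two)
    (integrable_const _), integral_fun_fst]
  simp [gramInf]

lemma integral_sq_gramDev_le {x : Fin n → Vec d} (hx : ∀ i, ‖x i‖ = 1) (i j : Fin n) :
    ∫ p, gramDev x i j p ^ 2 ∂(neuronLaw d) ≤ 1 := by
  have hL := memLp_gramEntry x i j
  unfold gramDev
  rw [integral_fun_fst (fun w => (Set.indicator {w : Vec d | 0 ≤ ⟪w, x i⟫ ∧ 0 ≤ ⟪w, x j⟫}
    (fun _ => ⟪x i, x j⟫) w - gramInf x i j) ^ 2)]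
  have h1 := variance_eq_integral hL.aemeasurable
  have h2 := variance_le_expectation_sq hL.aestronglyMeasurable
  have h3 : ∫ w, (Set.indicator {w : Vec d | 0 ≤ ⟪w, x i⟫ ∧ 0 ≤ ⟪w, x j⟫}
      (fun _ => ⟪x i, x j⟫) ^ 2) w ∂(stdGaussian (Vec d)) ≤ ∫ _w, (1 : ℝ) ∂(stdGaussian (Vec d)) := by
    refine integral_mono hL.integrable_sq (integrable_const _) fun w => ?_
    have h4 : ‖⟪x i, x j⟫‖ ≤ 1 := by simpa [hx] using norm_inner_le_norm (𝕜 := ℝ) (x i) (x j)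
    have h5 := (norm_indicator_le_norm_self
      (s := {w : Vec d | 0 ≤ ⟪w, x i⟫ ∧ 0 ≤ ⟪w, x j⟫}) (fun _ => ⟪x i, x j⟫) w).trans h4
    rw [Real.norm_eq_abs] at h5
    simp only [Pi.pow_apply]
    exact (sq_le_one_iff_abs_le_one _).mpr h5
  have h4 : ∫ _w, (1 : ℝ) ∂(stdGaussian (Vec d)) = 1 := by simp
  rw [h4] at h3
  simp only [probReal_univ, one_smul]
  exact (h1.symm.le.trans h2).trans h3

lemma empGram_sub_gramInf (hm : 0 < m) (x : Fin n → Vec d) (ω : Fin m → Vec d × ℝ)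
    (i j : Fin n) :
    empGram x (fun r => (ω r).1) i j - gramInf x i j = (∑ r, gramDev x i j (ω r)) / m := by
  have hmR : (m : ℝ) ≠ 0 := by exact_mod_cast hm.ne'
  simp only [empGram, gramDev, Matrix.of_apply, Finset.sum_sub_distrib]
  simp only [Finset.sum_const, Finset.card_univ, Fintype.card_fin, nsmul_eq_mul]
  field_simp

lemma integrable_sq_empGram_sub (hm : 0 < m) (x : Fin n → Vec d) (i j : Fin n) :
    Integrable (fun ω : Fin m → Vec d × ℝ =>
      (empGram x (fun r => (ω r).1) i j - gramInf x i j) ^ 2) (initLaw d m) := by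
  simp only [empGram_sub_gramInf hm, div_pow]
  exact (integrable_sq_sum (memLp_gramDev x i j)).div_const _

lemma integral_sq_empGram_sub_le (hm : 0 < m) {x : Fin n → Vec d} (hx : ∀ i, ‖x i‖ = 1) :
    ∫ ω, ∑ i, ∑ j, (empGram x (fun r => (ω r).1) i j - gramInf x i j) ^ 2 ∂(initLaw d m)
      ≤ n ^ 2 / m := by
  have hmR : (0 : ℝ) < m := by exact_mod_cast hm
  rw [integral_finsetSum _ fun i _ => integrable_finsetSum _ fun j _ =>
    integrable_sq_empGram_sub hm x i j]
  calc ∑ i, ∫ ω, ∑ j, (empGram x (fun r => (ω r).1) i j - gramInf x i j) ^ 2 ∂(initLaw d m)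
      ≤ ∑ _i : Fin n, ∑ _j : Fin n, 1 / (m : ℝ) := by
        refine Finset.sum_le_sum fun i _ => ?_
        rw [integral_finsetSum _ fun j _ => integrable_sq_empGram_sub hm x i j]
        refine Finset.sum_le_sum fun j _ => ?_
        simp only [empGram_sub_gramInf hm, div_pow]
        rw [integral_div, integral_sq_sum_eq (memLp_gramDev x i j) (integral_gramDev x i j),
          div_le_div_iff₀ (by positivity) hmR]
        nlinarith [integral_sq_gramDev_le hx i j, mul_pos hmR hmR]
    _ = n ^ 2 / m := by
        simp
        ring

lemma memLp_signed_relu (x : Vec d) :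
    MemLp (fun p : Vec d × ℝ => p.2 * relu ⟪p.1, x⟫) 2 (neuronLaw d) := by
  refine ((memLp_inner_stdGaussian x).comp_fst signLaw).mono ?_ ?_
  · refine Measurable.aestronglyMeasurable ?_
    unfold relu
    fun_prop
  · have h : ∀ᵐ p ∂(neuronLaw d), |p.2| = 1 :=
      Measure.quasiMeasurePreserving_snd.ae ae_abs_eq_one_signLaw
    filter_upwards [h] with p hp
    rw [norm_mul, Real.norm_eq_abs p.2, hp, one_mul, Real.norm_eq_abs, Real.norm_eq_abs]
    simpa [relu] using abs_relu_sub_relu_le ⟪p.1, x⟫ 0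

lemma integral_signed_relu (x : Vec d) :
    ∫ p : Vec d × ℝ, p.2 * relu ⟪p.1, x⟫ ∂(neuronLaw d) = 0 := by
  have h := integral_prod_mul (μ := stdGaussian (Vec d)) (ν := signLaw)
    (fun w => relu ⟪w, x⟫) (fun a => a)
  rw [integral_id_signLaw, mul_zero] at h
  simpa [mul_comm] using h

lemma integral_sq_signed_relu_le {x : Vec d} (hx : ‖x‖ = 1) :
    ∫ p : Vec d × ℝ, (p.2 * relu ⟪p.1, x⟫) ^ 2 ∂(neuronLaw d) ≤ 1 := by
  have hL := (memLp_inner_stdGaussian x).comp_fst signLaw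
  have h : ∀ᵐ p ∂(neuronLaw d), |p.2| = 1 :=
    Measure.quasiMeasurePreserving_snd.ae ae_abs_eq_one_signLaw
  calc ∫ p : Vec d × ℝ, (p.2 * relu ⟪p.1, x⟫) ^ 2 ∂(neuronLaw d)
      ≤ ∫ p : Vec d × ℝ, ⟪p.1, x⟫ ^ 2 ∂(neuronLaw d) := by
        refine integral_mono_ae (memLp_signed_relu x).integrable_sq hL.integrable_sq ?_
        filter_upwards [h] with p hp
        rw [sq_le_sq, abs_mul, hp, one_mul]
        simpa [relu] using abs_relu_sub_relu_le ⟪p.1, x⟫ 0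
    _ = 1 := by
        rw [integral_fun_fst (fun w : Vec d => ⟪w, x⟫ ^ 2), integral_sq_inner_stdGaussian hx]
        simp

lemma sq_network_eq (ω : Fin m → Vec d × ℝ) (x : Vec d) :
    network (fun r => (ω r).1) (fun r => (ω r).2) x ^ 2
      = (∑ r, (ω r).2 * relu ⟪(ω r).1, x⟫) ^ 2 / m := by
  rw [network, mul_pow, div_pow, Real.sq_sqrt (Nat.cast_nonneg _)]
  ring

lemma integrable_sq_network (x : Vec d) :
    Integrable (fun ω : Fin m → Vec d × ℝ =>
      network (fun r => (ω r).1) (fun r => (ω r).2) x ^ 2) (initLaw d m) := by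
  simp only [sq_network_eq]
  exact (integrable_sq_sum (memLp_signed_relu x)).div_const _

lemma integral_sq_network_le (hm : 0 < m) {x : Vec d} (hx : ‖x‖ = 1) :
    ∫ ω : Fin m → Vec d × ℝ, network (fun r => (ω r).1) (fun r => (ω r).2) x ^ 2 ∂(initLaw d m)
      ≤ 1 := by
  have hmR : (0 : ℝ) < m := by exact_mod_cast hm
  simp only [sq_network_eq]
  rw [integral_div, integral_sq_sum_eq (memLp_signed_relu x) (integral_signed_relu x),
    div_le_one hmR]
  exact mul_le_of_le_one_right hmR.le (integral_sq_signed_relu_le hx)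

/-- An integrable majorant of the initial error; its expectation is at most `(2 Y² + 2) n`. -/
lemma sqError_le_sum {x : Fin n → Vec d} {y : Fin n → ℝ} {Y : ℝ} (hy : ∀ i, |y i| ≤ Y)
    (a : Fin m → ℝ) (W : Weights d m) :
    sqError x y a W ≤ ∑ i, (2 * Y ^ 2 + 2 * network W a (x i) ^ 2) := by
  refine Finset.sum_le_sum fun i _ => ?_
  have h1 : y i ^ 2 ≤ Y ^ 2 := sq_le_sq' (neg_le_of_abs_le (hy i)) (le_of_abs_le (hy i))
  rw [residual]
  nlinarith [sq_nonneg (y i + network W a (x i))]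

lemma integral_majorant_le (hm : 0 < m) {x : Fin n → Vec d} (hx : ∀ i, ‖x i‖ = 1) (Y : ℝ) :
    ∫ ω : Fin m → Vec d × ℝ,
        ∑ i, (2 * Y ^ 2 + 2 * network (fun r => (ω r).1) (fun r => (ω r).2) (x i) ^ 2)
        ∂(initLaw d m) ≤ (2 * Y ^ 2 + 2) * n := by
  have hint : ∀ i, Integrable (fun ω : Fin m → Vec d × ℝ =>
      2 * network (fun r => (ω r).1) (fun r => (ω r).2) (x i) ^ 2) (initLaw d m) := fun i =>
    (integrable_sq_network (x i)).const_mul 2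
  have hint' : ∀ i, Integrable (fun ω : Fin m → Vec d × ℝ =>
      2 * Y ^ 2 + 2 * network (fun r => (ω r).1) (fun r => (ω r).2) (x i) ^ 2) (initLaw d m) :=
    fun i => (integrable_const _).add (hint i)
  rw [integral_finsetSum _ fun i _ => hint' i]
  calc _ ≤ ∑ _i : Fin n, (2 * Y ^ 2 + 2) := by
        refine Finset.sum_le_sum fun i _ => ?_
        have h1 := integral_sq_network_le hm (hx i)
        rw [integral_add (integrable_const _) (hint i), integral_const, probReal_univ, one_smul,
          integral_const_mul]
        linarith
    _ = (2 * Y ^ 2 + 2) * n := by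
        simp
        ring

/-- The initializations on which the training is controlled: the output weights are signs, the
initial error has its typical size, few neurons lie within `R` of an activation boundary, and the
empirical Gram matrix is close to its limit. -/
structure GoodInit (x : Fin n → Vec d) (y : Fin n → ℝ) (Y δ R : ℝ) (ω : Fin m → Vec d × ℝ) :
    Prop where
  abs_sign : ∀ r, |(ω r).2| = 1
  sqError_le : sqError x y (fun r => (ω r).2) (fun r => (ω r).1) ≤ (6 * Y ^ 2 + 6) * (n / δ)
  near_le : ∑ i, nearFraction (x i) R (fun r => (ω r).1) ≤ 3 * n * R / δ
  gram_le : ∑ i, ∑ j, (empGram x (fun r => (ω r).1) i j - gramInf x i j) ^ 2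
    ≤ 3 * n ^ 2 / (m * δ)

/-- Markov's inequality at the level that leaves probability `δ / 3`. -/
lemma measureReal_lt_le_third {Ω : Type*} [MeasurableSpace Ω] {μ : Measure Ω}
    [IsProbabilityMeasure μ] {F : Ω → ℝ} (hF : Integrable F μ) (h0 : ∀ ω, 0 ≤ F ω) {A δ : ℝ}
    (hA : 0 < A) (hδ : 0 < δ) (hm : ∫ ω, F ω ∂μ ≤ A) : μ.real {ω | 3 * A / δ < F ω} ≤ δ / 3 := by
  have h1 := mul_meas_ge_le_integral_of_nonneg (Filter.Eventually.of_forall h0) hF (3 * A / δ)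
  have h2 : μ.real {ω | 3 * A / δ < F ω} ≤ μ.real {ω | 3 * A / δ ≤ F ω} :=
    measureReal_mono fun ω hω => le_of_lt (α := ℝ) hω
  have h3 : 3 * A / δ * μ.real {ω | 3 * A / δ ≤ F ω} ≤ A := h1.trans hm
  have h4 : 3 * A / δ * (δ / 3) = A := by field_simp
  exact h2.trans (le_of_mul_le_mul_left (h3.trans h4.ge) (by positivity))

/-- Good initializations have probability at least `1 - δ`. -/
theorem one_sub_le_measureReal_of_goodInit (hm : 0 < m) (hn : 0 < n) {x : Fin n → Vec d}
    (hx : ∀ i, ‖x i‖ = 1) {y : Fin n → ℝ} {Y δ R : ℝ} (hy : ∀ i, |y i| ≤ Y) (hδ : 0 < δ)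
    (hR : 0 < R) {s : Set (Fin m → Vec d × ℝ)} (hs : ∀ ω, GoodInit x y Y δ R ω → ω ∈ s) :
    1 - δ ≤ (initLaw d m).real s := by
  have hmR : (0 : ℝ) < m := by exact_mod_cast hm
  have hnR : (0 : ℝ) < n := by exact_mod_cast hn
  have hae : ∀ᵐ ω ∂(initLaw d m), ∀ r, |(ω r).2| = 1 := by
    rw [ae_all_iff]
    intro r
    have h : ∀ᵐ p ∂(neuronLaw d), |p.2| = 1 :=
      Measure.quasiMeasurePreserving_snd.ae ae_abs_eq_one_signLaw
    exact (measurePreserving_eval (fun _ : Fin m => neuronLaw d) r).quasiMeasurePreserving.ae h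
  set B₀ : Set (Fin m → Vec d × ℝ) := {ω | ¬ ∀ r, |(ω r).2| = 1}
  set B₁ : Set (Fin m → Vec d × ℝ) := {ω | 3 * ((2 * Y ^ 2 + 2) * n) / δ
    < ∑ i, (2 * Y ^ 2 + 2 * network (fun r => (ω r).1) (fun r => (ω r).2) (x i) ^ 2)}
  set B₂ : Set (Fin m → Vec d × ℝ) := {ω | 3 * (n * R) / δ
    < ∑ i, nearFraction (x i) R (fun r => (ω r).1)}
  set B₃ : Set (Fin m → Vec d × ℝ) := {ω | 3 * (n ^ 2 / m) / δ
    < ∑ i, ∑ j, (empGram x (fun r => (ω r).1) i j - gramInf x i j) ^ 2}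
  have h0 : (initLaw d m).real B₀ = 0 := by
    rw [measureReal_eq_zero_iff]
    exact hae
  have h1 : (initLaw d m).real B₁ ≤ δ / 3 := by
    refine measureReal_lt_le_third (integrable_finsetSum _ fun i _ => ?_)
      (fun ω => by positivity) (by positivity) hδ (integral_majorant_le hm hx Y)
    exact (integrable_const _).add ((integrable_sq_network (x i)).const_mul 2)
  have h2 : (initLaw d m).real B₂ ≤ δ / 3 :=
    measureReal_lt_le_third (integrable_sum_nearFraction x R)
      (fun ω => Finset.sum_nonneg fun _ _ => nearFraction_nonneg _ _ _) (by positivity) hδ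
      (integral_sum_nearFraction_le hm hx hR.le)
  have h3 : (initLaw d m).real B₃ ≤ δ / 3 :=
    measureReal_lt_le_third (integrable_finsetSum _ fun i _ => integrable_finsetSum _ fun j _ =>
      integrable_sq_empGram_sub hm x i j) (fun ω => by positivity) (by positivity) hδ
      (integral_sq_empGram_sub_le hm hx)
  have hcover : (Set.univ : Set (Fin m → Vec d × ℝ)) ⊆ s ∪ (B₀ ∪ (B₁ ∪ (B₂ ∪ B₃))) := by
    intro ω _
    by_contra hω
    simp only [Set.mem_union, not_or] at hω
    obtain ⟨hωs, hω0, hω1, hω2, hω3⟩ := hω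
    refine hωs (hs ω ⟨not_not.mp hω0, ?_, ?_, ?_⟩)
    · refine (sqError_le_sum hy _ _).trans ((not_lt.mp hω1).trans (le_of_eq ?_))
      ring
    · refine (not_lt.mp hω2).trans (le_of_eq ?_)
      ring
    · refine (not_lt.mp hω3).trans (le_of_eq ?_)
      field_simp
  have h4 := measureReal_mono (μ := initLaw d m) hcover
  have h5 := measureReal_union_le (μ := initLaw d m) s (B₀ ∪ (B₁ ∪ (B₂ ∪ B₃)))
  have h6 := measureReal_union_le (μ := initLaw d m) B₀ (B₁ ∪ (B₂ ∪ B₃))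
  have h7 := measureReal_union_le (μ := initLaw d m) B₁ (B₂ ∪ B₃)
  have h8 := measureReal_union_le (μ := initLaw d m) B₂ B₃
  rw [probReal_univ] at h4
  linarith

end Init

/-! ### Choice of the constants -/

section Constants

variable {d n m : ℕ}

lemma exp_neg_div_mul_le {p τ A ε k : ℝ} (hp : 1 ≤ p) (hτ : 0 < τ) (hA : 0 ≤ A) (hε : 0 < ε)
    (hk : p * τ * Real.log (1 + A / ε) ≤ k) : Real.exp (-(k / τ)) * (p * A) ≤ ε := by
  have hx : 0 ≤ A / ε := by positivity
  have h1 : p * Real.log (1 + A / ε) ≤ k / τ := by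
    rw [le_div_iff₀ hτ]
    linarith
  -- Bernoulli's inequality absorbs the factor `p` into the exponent
  have h2 : p * (A / ε) ≤ Real.exp (k / τ) := by
    have h3 := one_add_mul_self_le_rpow_one_add (by linarith : -1 ≤ A / ε) hp
    rw [Real.rpow_def_of_pos (by linarith), mul_comm (Real.log _)] at h3
    linarith [Real.exp_le_exp.mpr h1]
  rw [Real.exp_neg, inv_mul_le_iff₀ (Real.exp_pos _)]
  calc p * A = p * (A / ε) * ε := by field_simp
    _ ≤ Real.exp (k / τ) * ε := by gcongr

/-- The budget `S` covers the travel during the warm-up and during the subsequent contraction. -/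
lemma sqrt_add_sqrt_le_budget {Q N η α β Lam lam δ T ℓ S : ℝ} (hQ : 1 ≤ Q) (hN : 1 ≤ N)
    (hα : 0 < α) (hβ : α ^ 2 ≤ β) (hlam : 0 < lam) (hδ : 0 < δ) (hT : 0 ≤ T)
    (hℓ : 0 ≤ ℓ) (hS : 0 ≤ S)
    (hS2 : 8 * Q * (N ^ 2 / (lam ^ 2 * δ) + η ^ 2 * Lam ^ 2 / (α ^ 2 * lam ^ 2) * ℓ
      + η ^ 2 / α ^ 2 * (1 + T) * (1 + ℓ)) ≤ S ^ 2) :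
    √(η ^ 2 * T * (2 / β * ℓ)) + 2 / lam * √(Q * (N / δ + η ^ 2 * Lam ^ 2 / β * ℓ)) ≤ S := by
  have hα2 : 0 < α ^ 2 := by positivity
  have hβ0 : 0 < β := hα2.trans_le hβ
  have h1 : √(η ^ 2 * T * (2 / β * ℓ)) ^ 2 ≤ 2 * (η ^ 2 / α ^ 2 * (1 + T) * (1 + ℓ)) := by
    rw [Real.sq_sqrt (by positivity)]
    calc η ^ 2 * T * (2 / β * ℓ) ≤ η ^ 2 * (1 + T) * (2 / α ^ 2 * (1 + ℓ)) := by
          gcongr <;> linarith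
      _ = _ := by ring
  have h2 : (2 / lam * √(Q * (N / δ + η ^ 2 * Lam ^ 2 / β * ℓ))) ^ 2
      ≤ 4 * Q * (N ^ 2 / (lam ^ 2 * δ) + η ^ 2 * Lam ^ 2 / (α ^ 2 * lam ^ 2) * ℓ) := by
    rw [mul_pow, Real.sq_sqrt (by positivity)]
    calc (2 / lam) ^ 2 * (Q * (N / δ + η ^ 2 * Lam ^ 2 / β * ℓ))
        ≤ (2 / lam) ^ 2 * (Q * (N ^ 2 / δ + η ^ 2 * Lam ^ 2 / α ^ 2 * ℓ)) := by
          gcongr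
          nlinarith
      _ = _ := by
          field_simp
          ring
  refine le_of_sq_le_sq (le_trans ?_ hS2) hS
  have h3 : 0 ≤ η ^ 2 / α ^ 2 * (1 + T) * (1 + ℓ) := by positivity
  have h4 := mul_le_mul_of_nonneg_right hQ h3
  refine (add_sq_le).trans ?_
  linarith

/-- The radius in which the weights are confined: `c λ₀ δ / (n² √κ)`, where `κ ≥ 1` is the factor
by which the width exceeds the basic requirement. -/
def radius (x : Fin n → Vec d) (c κ δ : ℝ) : ℝ := c * lambdaZero x * δ / (n ^ 2 * √κ)

/-- The accumulated step lengths that keep the weights within `radius`. -/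
def budget (m : ℕ) (x : Fin n → Vec d) (c κ δ : ℝ) : ℝ := radius x c κ δ * √(m : ℝ) / n

lemma sq_budget_ge (hn : 0 < n) (x : Fin n → Vec d) {c κ δ K M : ℝ} (hκ : 0 < κ)
    (hm : K * M * κ ≤ m) :
    c ^ 2 * K * (lambdaZero x ^ 2 * δ ^ 2 / n ^ 6 * M) ≤ budget m x c κ δ ^ 2 := by
  have hnR : (0 : ℝ) < n := by exact_mod_cast hn
  have h1 : budget m x c κ δ ^ 2 = c ^ 2 * lambdaZero x ^ 2 * δ ^ 2 / (n ^ 6 * κ) * m := by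
    have h2 := Real.sq_sqrt hκ.le
    rw [budget, radius, div_pow, mul_pow, div_pow, Real.sq_sqrt (Nat.cast_nonneg _),
      mul_pow (_ ^ 2), h2]
    field_simp
  rw [h1]
  calc _ = c ^ 2 * lambdaZero x ^ 2 * δ ^ 2 / (n ^ 6 * κ) * (K * M * κ) := by field_simp
    _ ≤ _ := by gcongr

lemma budget_nonneg (m : ℕ) (x : Fin n → Vec d) {c κ δ : ℝ} (hc : 0 < c)
    (hx : 0 < lambdaZero x) (hδ : 0 < δ) : 0 ≤ budget m x c κ δ := by
  unfold budget radius
  positivity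

/-- The residual vectors along AdaLoss. -/
abbrev resSeq (x : Fin n → Vec d) (y : Fin n → ℝ) (b₀ η α : ℝ) (ω : Fin m → Vec d × ℝ) (k : ℕ) :
    EuclideanSpace ℝ (Fin n) :=
  resVec x y (fun r => (ω r).2)
    (iterate x y b₀ η α (fun r => (ω r).2) (fun r => (ω r).1) k).1

/-- The step-size denominators along AdaLoss. -/
abbrev bSeq (x : Fin n → Vec d) (y : Fin n → ℝ) (b₀ η α : ℝ) (ω : Fin m → Vec d × ℝ) (k : ℕ) : ℝ :=
  (iterate x y b₀ η α (fun r => (ω r).2) (fun r => (ω r).1) k).2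

lemma trainError_eq (x : Fin n → Vec d) (y : Fin n → ℝ) (b₀ η α : ℝ) (ω : Fin m → Vec d × ℝ)
    (k : ℕ) : trainError x y b₀ η α ω k = ‖resSeq x y b₀ η α ω k‖ ^ 2 :=
  (sq_norm_resVec _ _ _ _).symm

/-- On good initializations AdaLoss is nearly linear with `ρ = 10 c λ₀ / √κ`. -/
lemma GoodInit.nearlyLinear {x : Fin n → Vec d} (hx : ∀ i, ‖x i‖ = 1) {y : Fin n → ℝ}
    {Y δ c κ K b₀ η α : ℝ} (hm : 0 < m) (hn : 0 < n) (hlam : 0 < lambdaZero x) (hδ : 0 < δ)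
    (hδ1 : δ < 1) (hc : 0 < c) (hκ : 0 < κ) (hb₀ : 0 < b₀) (hη : 0 < η)
    (hK : 3 ≤ c ^ 2 * K) (hwidth : K * widthAbove x δ * κ ≤ m) {ω : Fin m → Vec d × ℝ}
    (hω : GoodInit x y Y δ (radius x c κ δ) ω) :
    NearlyLinear (Matrix.toEuclideanLin (gramInf x)) η (α ^ 2 * √(n : ℝ))
      (10 * c * lambdaZero x / √κ) (budget m x c κ δ)
      (resSeq x y b₀ η α ω) (bSeq x y b₀ η α ω) := by
  have hmR : (0 : ℝ) < m := by exact_mod_cast hm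
  have hnR : (0 : ℝ) < n := by exact_mod_cast hn
  have hn1 : (1 : ℝ) ≤ n := by exact_mod_cast hn
  have hl1 : lambdaZero x ≤ 1 := lambdaZero_le_one hx hlam
  have hκs : 0 < √κ := Real.sqrt_pos.mpr hκ
  have hγ : 3 * (n : ℝ) ^ 2 / (m * δ) ≤ (c * lambdaZero x / √κ) ^ 2 := by
    rw [div_pow, Real.sq_sqrt hκ.le, div_le_div_iff₀ (by positivity) hκ]
    have h1 : (n : ℝ) ^ 2 ≤ lambdaZero x ^ 2 * δ * widthAbove x δ := by
      have h2 : lambdaZero x ^ 2 * δ * widthAbove x δ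
          = n ^ 8 / (lambdaZero x ^ 2 * δ ^ 2) := by
        rw [widthAbove]
        field_simp
      rw [h2, le_div_iff₀ (by positivity)]
      have h3 : lambdaZero x ^ 2 * δ ^ 2 ≤ 1 := by
        rw [← mul_pow]
        exact pow_le_one₀ (by positivity) (mul_le_one₀ hl1 hδ.le hδ1.le)
      calc (n : ℝ) ^ 2 * (lambdaZero x ^ 2 * δ ^ 2) ≤ (n : ℝ) ^ 2 * 1 := by gcongr
        _ ≤ (n : ℝ) ^ 8 := by
          rw [mul_one]
          exact pow_le_pow_right₀ hn1 (by norm_num)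
    have hw0 : 0 < widthAbove x δ := by
      unfold widthAbove
      positivity
    calc 3 * (n : ℝ) ^ 2 * κ
        ≤ c ^ 2 * K * (lambdaZero x ^ 2 * δ * widthAbove x δ) * κ := by gcongr
      _ = c ^ 2 * lambdaZero x ^ 2 * δ * (K * widthAbove x δ * κ) := by ring
      _ ≤ c ^ 2 * lambdaZero x ^ 2 * δ * m := by gcongr
      _ = (c * lambdaZero x) ^ 2 * (m * δ) := by ring
  have h := nearlyLinear_of_init hx y hm hn (α := α) hb₀ hη hω.abs_sign hω.near_le
    (hω.gram_le.trans hγ) (by positivity)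
  have hρ : 3 * n * (3 * n * radius x c κ δ / δ) + c * lambdaZero x / √κ
      = 10 * c * lambdaZero x / √κ := by
    rw [radius]
    field_simp
    ring
  rwa [hρ] at h

lemma rpow_three_halves (n : ℕ) : (n : ℝ) ^ (3 / 2 : ℝ) = n * √(n : ℝ) := by
  rw [show (3 / 2 : ℝ) = 1 + 1 / 2 by norm_num,
    Real.rpow_add_of_nonneg (Nat.cast_nonneg _) (by norm_num) (by norm_num), Real.rpow_one,
    Real.sqrt_eq_rpow]

end Constants

/-! ### Convergence above and below the critical threshold -/

section Convergence

variable {d n m : ℕ} {x : Fin n → Vec d}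

lemma mul_scaleAbove_eq (x : Fin n → Vec d) (b₀ η α δ Q : ℝ) :
    2 * (b₀ + 2 * (α ^ 2 * √(n : ℝ)) / (η * lambdaZero x) * (Q * (n / δ))) / (η * lambdaZero x)
      = 2 * (b₀ / (η * lambdaZero x))
        + 4 * Q * (α ^ 2 * (n : ℝ) ^ (3 / 2 : ℝ) / (η ^ 2 * lambdaZero x ^ 2 * δ)) := by
  rw [rpow_three_halves]
  ring

lemma mul_scaleBelow_eq (x : Fin n → Vec d) (hn : 0 < n) {η α : ℝ} (hη : η ≠ 0)
    (hα : α ≠ 0) (C b₀ δ Q : ℝ) :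
    2 * (η * threshold x C + 2 * (α ^ 2 * √(n : ℝ)) / (η * lambdaZero x)
        * (Q * errorBelow x C b₀ η α δ)) / (η * lambdaZero x)
      = 2 * (threshold x C / lambdaZero x)
        + 4 * Q * (α ^ 2 * (n : ℝ) ^ (3 / 2 : ℝ) / (η ^ 2 * lambdaZero x ^ 2 * δ)
          + lambdaMax x ^ 2 / lambdaZero x ^ 2 * logGap x C b₀ η) := by
  have hs : √(n : ℝ) ≠ 0 := by positivity
  rw [rpow_three_halves, errorBelow]
  have h1 : 2 * (η * threshold x C + 2 * (α ^ 2 * √(n : ℝ)) / (η * lambdaZero x)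
        * (Q * (n / δ + η ^ 2 * lambdaMax x ^ 2 / (α ^ 2 * √(n : ℝ)) * logGap x C b₀ η)))
        / (η * lambdaZero x)
      = 2 * (threshold x C / lambdaZero x) * (η / η)
        + 4 * Q * (α ^ 2 * (n * √(n : ℝ)) / (η ^ 2 * lambdaZero x ^ 2 * δ)
          + lambdaMax x ^ 2 / lambdaZero x ^ 2 * logGap x C b₀ η
            * ((η ^ 2 / η ^ 2) * ((α ^ 2 * √(n : ℝ)) / (α ^ 2 * √(n : ℝ))))) := by
    ring
  rw [h1, div_self hη, div_self (pow_ne_zero 2 hη),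
    div_self (mul_ne_zero (pow_ne_zero 2 hα) hs)]
  ring

/-- Linear convergence from the start when `b₀ / η` is above the threshold. -/
theorem convergence_above {y : Fin n → ℝ} {C b₀ η α δ ρ S Q K : ℝ}
    {ω : Fin m → Vec d × ℝ} (hn : 0 < n)
    (h : NearlyLinear (Matrix.toEuclideanLin (gramInf x)) η (α ^ 2 * √(n : ℝ)) ρ S
      (resSeq x y b₀ η α ω) (bSeq x y b₀ η α ω))
    (hlam : 0 < lambdaZero x) (hC : 1 ≤ C) (hb₀ : 0 < b₀) (hη : 0 < η) (hα : 0 < α) (hδ : 0 < δ)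
    (hρ : ρ ≤ lambdaZero x / 2) (hQ : 1 ≤ Q) (hK : 4 * Q ^ 2 ≤ K)
    (hE : trainError x y b₀ η α ω 0 ≤ Q * (n / δ))
    (hS : 2 / lambdaZero x * √(Q * (n / δ)) ≤ S) (hb : threshold x C ≤ b₀ / η) :
    (∀ k : ℕ, trainError x y b₀ η α ω k ≤
      Real.exp (-(k / (K * scaleAbove x b₀ η α δ))) * trainError x y b₀ η α ω 0) ∧
    ∀ ε : ℝ, 0 < ε → ∀ k : ℕ,
      K * scaleAbove x b₀ η α δ * Real.log (1 + n / δ / ε) ≤ k →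
        trainError x y b₀ η α ω k ≤ ε := by
  have hH := spectralBounds_gramInf hlam
  have hnR : (0 : ℝ) < n := by exact_mod_cast hn
  have hβ : 0 < α ^ 2 * √(n : ℝ) := by positivity
  set r := resSeq x y b₀ η α ω with hr
  set b := bSeq x y b₀ η α ω with hbdef
  have hb0 : b 0 = b₀ := rfl
  simp only [trainError_eq] at hE ⊢
  have hthr : η * (lambdaZero x + lambdaMax x) / 2 ≤ b (0 + 1) := by
    refine le_trans ?_ (h.b_mono hβ (Nat.zero_le (0 + 1)))
    rw [hb0]
    rw [threshold, le_div_iff₀ hη] at hb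
    have : 0 ≤ (C - 1) * (lambdaZero x + lambdaMax x) * η :=
      mul_nonneg (mul_nonneg (by linarith) (by linarith [hH.le])) hη.le
    linarith
  have hbud : travel η b r 0 + 2 / lambdaZero x * ‖r 0‖ ≤ S := by
    refine le_trans ?_ hS
    have h1 : ‖r 0‖ ≤ √(Q * (n / δ)) := Real.le_sqrt_of_sq_le hE
    simp only [travel, Finset.range_zero, Finset.sum_empty, zero_add]
    gcongr
  have hD1 : 0 < b₀ / (η * lambdaZero x) := by positivity
  have hD2 : 0 ≤ α ^ 2 * (n : ℝ) ^ (3 / 2 : ℝ) / (η ^ 2 * lambdaZero x ^ 2 * δ) := by positivity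
  have hD : 0 < scaleAbove x b₀ η α δ := by
    rw [scaleAbove]
    linarith
  have hτ : 2 * (b 0 + 2 * (α ^ 2 * √(n : ℝ)) / (η * lambdaZero x) * ‖r 0‖ ^ 2)
      / (η * lambdaZero x) ≤ 4 * Q * scaleAbove x b₀ η α δ := by
    rw [hb0]
    calc _ ≤ 2 * (b₀ + 2 * (α ^ 2 * √(n : ℝ)) / (η * lambdaZero x) * (Q * (n / δ)))
            / (η * lambdaZero x) := by gcongr
      _ ≤ _ := by
        rw [mul_scaleAbove_eq, scaleAbove]
        nlinarith
  have hKQ : 4 * Q ≤ K := by nlinarith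
  constructor
  · intro k
    have h1 := h.sq_norm_add_le hH hη hβ hρ 0 hthr hbud (τ := K * scaleAbove x b₀ η α δ)
      (hτ.trans (by gcongr)) k
    simpa using h1
  · intro ε hε k hk
    have h1 := h.sq_norm_add_le hH hη hβ hρ 0 hthr hbud hτ k
    rw [zero_add] at h1
    refine h1.trans (le_trans ?_ (exp_neg_div_mul_le (A := n / δ) (k := k) hQ
      (τ := 4 * Q * scaleAbove x b₀ η α δ) (by positivity) (by positivity) hε ?_))
    · gcongr
    · refine le_trans ?_ hk
      have hlog : 0 ≤ Real.log (1 + n / δ / ε) := by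
        refine Real.log_nonneg ?_
        have : 0 ≤ (n : ℝ) / δ / ε := by positivity
        linarith
      have h2 : Q * (4 * Q * scaleAbove x b₀ η α δ) ≤ K * scaleAbove x b₀ η α δ := by
        nlinarith
      gcongr

/-- Convergence after a warm-up of length at most `T` when `b₀ / η` is below the threshold. -/
theorem convergence_below {y : Fin n → ℝ} {C Cmax b₀ η α δ ρ S Q K ε T : ℝ}
    {ω : Fin m → Vec d × ℝ} (hn : 0 < n)
    (h : NearlyLinear (Matrix.toEuclideanLin (gramInf x)) η (α ^ 2 * √(n : ℝ)) ρ S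
      (resSeq x y b₀ η α ω) (bSeq x y b₀ η α ω))
    (hlam : 0 < lambdaZero x) (hC : 1 ≤ C) (hCmax : C ≤ Cmax) (hb₀ : 0 < b₀) (hη : 0 < η)
    (hα : 0 < α) (hδ : 0 < δ) (hρ : ρ ≤ lambdaZero x / 2) (hQ : 6 ≤ Q)
    (hK : Q * (4 * Q + 2 * Cmax) ≤ K)
    (hE : trainError x y b₀ η α ω 0 ≤ Q * (n / δ))
    (hb : b₀ / η < threshold x C) (hε : 0 < ε)
    (hS : √(η ^ 2 * climb n α ε b₀ (η * threshold x C)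
        * (2 / (α ^ 2 * √(n : ℝ)) * logGap x C b₀ η))
      + 2 / lambdaZero x * √(Q * errorBelow x C b₀ η α δ) ≤ S)
    (hT0 : 0 ≤ T)
    (hT : ∀ k, bSeq x y b₀ η α ω k < η * threshold x C →
      (∀ j < k, ε < ‖resSeq x y b₀ η α ω j‖ ^ 2) → (k : ℝ) ≤ T) :
    (∃ k : ℕ, (k : ℝ) ≤ T ∧ trainError x y b₀ η α ω k ≤ ε) ∨
      ∀ k : ℕ, T + K * scaleBelow x C b₀ η α δ * Real.log (1 + errorBelow x C b₀ η α δ / ε) ≤ k →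
        trainError x y b₀ η α ω k ≤ ε := by
  have hH := spectralBounds_gramInf hlam
  have hle := hH.le
  have hnR : (0 : ℝ) < n := by exact_mod_cast hn
  have hβ : 0 < α ^ 2 * √(n : ℝ) := by positivity
  have hbB : b₀ < η * threshold x C := by
    rw [div_lt_iff₀ hη] at hb
    linarith
  have hℓ : 0 ≤ logGap x C b₀ η := Real.log_nonneg ((one_le_div hb₀).mpr hbB.le)
  have hLam : 0 < lambdaMax x := hlam.trans_le hle
  have hE1 : 0 < errorBelow x C b₀ η α δ := by
    rw [errorBelow]
    positivity
  set r := resSeq x y b₀ η α ω with hr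
  set b := bSeq x y b₀ η α ω with hbdef
  have hb0 : b 0 = b₀ := rfl
  simp only [trainError_eq] at hE ⊢
  have hthr : η * (lambdaZero x + lambdaMax x) / 2 ≤ η * threshold x C := by
    have : 0 ≤ (C - 1) * (lambdaZero x + lambdaMax x) * η :=
      mul_nonneg (mul_nonneg (by linarith) (by linarith)) hη.le
    rw [threshold]
    linarith
  have hD1 : 0 < lambdaMax x / lambdaZero x := by positivity
  have hD2 : 0 ≤ α ^ 2 * (n : ℝ) ^ (3 / 2 : ℝ) / (η ^ 2 * lambdaZero x ^ 2 * δ) := by positivity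
  have hD3 : 0 ≤ lambdaMax x ^ 2 / lambdaZero x ^ 2 * logGap x C b₀ η := by positivity
  have hD : 0 < scaleBelow x C b₀ η α δ := by
    rw [scaleBelow]
    linarith
  have hτ : 2 * (η * threshold x C + 2 * (α ^ 2 * √(n : ℝ)) / (η * lambdaZero x)
        * (Q * errorBelow x C b₀ η α δ)) / (η * lambdaZero x)
      ≤ (4 * Q + 2 * Cmax) * scaleBelow x C b₀ η α δ := by
    rw [mul_scaleBelow_eq x hn hη.ne' hα.ne', scaleBelow]
    have h1 : threshold x C / lambdaZero x ≤ Cmax * (lambdaMax x / lambdaZero x) := by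
      rw [← mul_div_assoc]
      refine div_le_div_of_nonneg_right ?_ hlam.le
      rw [threshold]
      nlinarith
    have h2 : 0 ≤ Q * (lambdaMax x / lambdaZero x) := by positivity
    have h3 := mul_nonneg (by linarith : 0 ≤ Cmax) hD2
    have h4 := mul_nonneg (by linarith : 0 ≤ Cmax) hD3
    linarith
  have hE₁ : ‖r 0‖ ^ 2 + 9 / 2 * (lambdaMax x ^ 2 * η ^ 2 / (α ^ 2 * √(n : ℝ))
      * Real.log (η * threshold x C / b 0)) ≤ Q * errorBelow x C b₀ η α δ := by
    rw [errorBelow, mul_add]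
    refine add_le_add hE ?_
    rw [hb0, ← logGap, mul_comm (lambdaMax x ^ 2)]
    gcongr
    linarith
  rcases h.exists_le_or_linear_rate hH hη hβ hρ hε (hb0 ▸ hbB) hthr hE₁ hS hT0 hT hτ with
    hex | ⟨s, hsT, hs⟩
  · exact Or.inl hex
  right
  intro k hk
  have hlog : 0 ≤ Real.log (1 + errorBelow x C b₀ η α δ / ε) := by
    refine Real.log_nonneg ?_
    have : 0 ≤ errorBelow x C b₀ η α δ / ε := by positivity
    linarith
  have hKD : Q * ((4 * Q + 2 * Cmax) * scaleBelow x C b₀ η α δ)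
      ≤ K * scaleBelow x C b₀ η α δ := by
    rw [← mul_assoc]
    gcongr
  have hmain := mul_le_mul_of_nonneg_right hKD hlog
  have hprod : 0 ≤ Q * ((4 * Q + 2 * Cmax) * scaleBelow x C b₀ η α δ)
      * Real.log (1 + errorBelow x C b₀ η α δ / ε) := by
    have : 0 ≤ 4 * Q + 2 * Cmax := by linarith
    positivity
  have hsk : s ≤ k := by
    have : (s : ℝ) ≤ k := by linarith
    exact_mod_cast this
  obtain ⟨l, rfl⟩ := Nat.exists_eq_add_of_le hsk
  refine (hs l).trans (exp_neg_div_mul_le (by linarith) ?_ hE1.le hε ?_)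
  · have : 0 < 4 * Q + 2 * Cmax := by linarith
    positivity
  · push_cast at hk
    linarith

lemma climb_nonneg (n : ℕ) {α ε b B : ℝ} (hα : 0 < α) (hε : 0 < ε) (hb : 0 < b) (hbB : b ≤ B) :
    0 ≤ climb n α ε b B := by
  refine div_nonneg ?_ (by positivity)
  have : b ^ 2 ≤ B ^ 2 := by gcongr
  linarith

/-- The width requirement below the threshold provides the travel budget. -/
lemma budget_below {C b₀ η α δ Q K ε c κ : ℝ} (hn : 0 < n)
    (hlam : 0 < lambdaZero x) (hb₀ : 0 < b₀) (hη : 0 < η) (hα : 0 < α) (hδ : 0 < δ)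
    (hQ : 1 ≤ Q) (hc : 0 < c) (hκ : 0 < κ) (hK : 8 * Q ≤ c ^ 2 * K)
    (hb : b₀ / η < threshold x C) (hε : 0 < ε)
    (hwidth : K * widthBelow x C b₀ η α δ ε * κ ≤ m) :
    √(η ^ 2 * climb n α ε b₀ (η * threshold x C)
        * (2 / (α ^ 2 * √(n : ℝ)) * logGap x C b₀ η))
      + 2 / lambdaZero x * √(Q * errorBelow x C b₀ η α δ) ≤ budget m x c κ δ := by
  have hnR : (0 : ℝ) < n := by exact_mod_cast hn
  have hn1 : (1 : ℝ) ≤ n := by exact_mod_cast hn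
  have hbB : b₀ < η * threshold x C := by
    rw [div_lt_iff₀ hη] at hb
    linarith
  have hℓ : 0 ≤ logGap x C b₀ η := Real.log_nonneg ((one_le_div hb₀).mpr hbB.le)
  have hT := climb_nonneg n hα hε hb₀ hbB.le
  have hs1 : 1 ≤ √(n : ℝ) := Real.one_le_sqrt.mpr hn1
  have hβ : α ^ 2 ≤ α ^ 2 * √(n : ℝ) := le_mul_of_one_le_right (by positivity) hs1
  refine sqrt_add_sqrt_le_budget hQ hn1 hα hβ hlam hδ hT hℓ
    (budget_nonneg m x hc hlam hδ) ?_
  refine le_trans ?_ (sq_budget_ge hn x hκ hwidth)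
  have h1 : lambdaZero x ^ 2 * δ ^ 2 / n ^ 6 * widthBelow x C b₀ η α δ ε
      = (n : ℝ) ^ 2 / (lambdaZero x ^ 2 * δ)
        + η ^ 2 * lambdaMax x ^ 2 / (α ^ 2 * lambdaZero x ^ 2) * logGap x C b₀ η
        + η ^ 2 / α ^ 2 * (1 + climb n α ε b₀ (η * threshold x C))
          * (1 + logGap x C b₀ η) := by
    rw [widthBelow]
    field_simp
  rw [h1]
  have h2 : 0 ≤ (n : ℝ) ^ 2 / (lambdaZero x ^ 2 * δ)
        + η ^ 2 * lambdaMax x ^ 2 / (α ^ 2 * lambdaZero x ^ 2) * logGap x C b₀ η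
        + η ^ 2 / α ^ 2 * (1 + climb n α ε b₀ (η * threshold x C))
          * (1 + logGap x C b₀ η) := by positivity
  exact mul_le_mul_of_nonneg_right hK h2

lemma widthAbove_le_widthBelow {C b₀ η α δ ε : ℝ} (hb₀ : 0 < b₀)
    (hη : 0 < η) (hα : 0 < α) (hδ : 0 < δ) (hb : b₀ / η < threshold x C) (hε : 0 < ε) :
    widthAbove x δ ≤ widthBelow x C b₀ η α δ ε := by
  have hbB : b₀ < η * threshold x C := by
    rw [div_lt_iff₀ hη] at hb
    linarith
  have hℓ : 0 ≤ logGap x C b₀ η := Real.log_nonneg ((one_le_div hb₀).mpr hbB.le)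
  have hT := climb_nonneg n hα hε hb₀ hbB.le
  rw [widthBelow, widthAbove, add_assoc]
  refine le_add_of_nonneg_right ?_
  positivity

end Convergence

/-! ### High-probability convergence -/

/-- In the first stage of the warm-up the linearization errors cost at most half of the component
along the top eigenvector. The factor `κ` in the width is what makes this true. -/
lemma relative_loss_le {N δ Δ M Q c lam Lam κ z : ℝ} (hδ : 0 < δ) (hΔ : 0 < Δ)
    (hM : 0 ≤ M) (hQ : 1 ≤ Q) (hc : 0 < c) (hcQ : 320 * c * Q ≤ 1) (hlam : 0 < lam)
    (hle : lam ≤ Lam) (hκ1 : 0 < κ) (hκ : N / (δ * Δ ^ 2) * (1 + M) ^ 2 ≤ κ) (hz : 0 ≤ z)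
    (hz2 : z ^ 2 ≤ Q * (N / δ)) :
    4 * (2 * (10 * c * lam / √κ) / Lam * (4 * M + 1)) * z ≤ Δ := by
  have hLam : 0 < Lam := hlam.trans_le hle
  have hs : 0 < √κ := Real.sqrt_pos.mpr hκ1
  have h1 : z * (1 + M) ≤ Q * Δ * √κ := by
    refine le_of_sq_le_sq ?_ (by positivity)
    rw [mul_pow, mul_pow _ (√κ), Real.sq_sqrt hκ1.le]
    calc z ^ 2 * (1 + M) ^ 2 ≤ Q * (N / δ) * (1 + M) ^ 2 := by gcongr
      _ = Q * Δ ^ 2 * (N / (δ * Δ ^ 2) * (1 + M) ^ 2) := by field_simp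
      _ ≤ Q * Δ ^ 2 * κ := by gcongr
      _ ≤ (Q * Δ) ^ 2 * κ := by
        rw [mul_pow]
        gcongr
        nlinarith
  calc 4 * (2 * (10 * c * lam / √κ) / Lam * (4 * M + 1)) * z
      = 80 * c / √κ * (lam / Lam) * ((4 * M + 1) * z) := by
        field_simp
        ring
    _ ≤ 80 * c / √κ * 1 * (4 * (z * (1 + M))) := by
        have h2 : lam / Lam ≤ 1 := (div_le_one hLam).mpr hle
        refine mul_le_mul (by gcongr) ?_ (by positivity) (by positivity)
        linarith
    _ ≤ 80 * c / √κ * 1 * (4 * (Q * Δ * √κ)) := by gcongr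
    _ = 320 * c * Q * Δ := by
        field_simp
        ring
    _ ≤ 1 * Δ := by gcongr
    _ = Δ := one_mul _

/-- The relations between the constants: `Q` bounds the initial error in units of `n / δ`, the
constant `c` fixes the radius of confinement, and `K` is the constant of the theorem. -/
structure ConstantRelations (Y Cmax Q c K : ℝ) : Prop where
  Q_eq : Q = 6 * Y ^ 2 + 6
  c_pos : 0 < c
  c_le : 320 * c * Q ≤ 1
  width : 8 * Q ≤ c ^ 2 * K
  rate : Q * (4 * Q + 2 * Cmax) ≤ K

namespace ConstantRelations

lemma exists_of_nonneg (Y : ℝ) {Cmax : ℝ} (hC : 0 ≤ Cmax) :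
    ∃ Q c K, ConstantRelations Y Cmax Q c K := by
  obtain ⟨Q, hQdef⟩ : ∃ Q : ℝ, Q = 6 * Y ^ 2 + 6 := ⟨_, rfl⟩
  have hQ : 0 < Q := by
    rw [hQdef]
    positivity
  refine ⟨Q, 1 / (320 * Q), 8 * Q * (320 * Q) ^ 2 + Q * (4 * Q + 2 * Cmax), hQdef, by positivity,
    ?_, ?_, le_add_of_nonneg_left (by positivity)⟩
  · field_simp
    rfl
  · have h1 : (1 / (320 * Q)) ^ 2 * (8 * Q * (320 * Q) ^ 2) = 8 * Q := by
      field_simp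
    rw [mul_add, h1]
    exact le_add_of_nonneg_right (by positivity)

variable {Y Cmax Q c K : ℝ}

lemma six_le (hK : ConstantRelations Y Cmax Q c K) : 6 ≤ Q := by
  rw [hK.Q_eq]
  linarith [sq_nonneg Y]

lemma four_mul_sq_le (hK : ConstantRelations Y Cmax Q c K) (hC : 0 ≤ Cmax) : 4 * Q ^ 2 ≤ K := by
  have h1 := hK.rate
  have h2 : 0 ≤ Q * Cmax := mul_nonneg (by linarith [hK.six_le]) hC
  linarith

lemma four_le (hK : ConstantRelations Y Cmax Q c K) (hC : 0 ≤ Cmax) : 4 ≤ K := by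
  nlinarith [hK.four_mul_sq_le hC, hK.six_le]

variable {d n m : ℕ} {x : Fin n → Vec d} {y : Fin n → ℝ} {C b₀ η α δ ε κ : ℝ}

lemma error_le_half (hK : ConstantRelations Y Cmax Q c K) (hlam : 0 < lambdaZero x)
    (hκ : 1 ≤ κ) : 10 * c * lambdaZero x / √κ ≤ lambdaZero x / 2 := by
  have h1 : 1 ≤ √κ := Real.one_le_sqrt.mpr hκ
  have h2 : 10 * c ≤ 1 / 2 := by nlinarith [hK.c_le, hK.six_le, hK.c_pos]
  rw [div_le_iff₀ (by linarith)]
  nlinarith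

/-- An event has probability at least `1 - δ` if it contains every good initialization on which
AdaLoss is nearly linear. -/
lemma one_sub_le_measureReal (hK : ConstantRelations Y Cmax Q c K) (hC : 0 ≤ Cmax)
    (hx : ∀ i, ‖x i‖ = 1) (hy : ∀ i, |y i| ≤ Y) (hn : 0 < n) (hlam : 0 < lambdaZero x)
    (hb₀ : 0 < b₀) (hη : 0 < η) (hδ : 0 < δ) (hδ1 : δ < 1) (hκ : 0 < κ)
    (hm : K * widthAbove x δ * κ ≤ m) {s : Set (Fin m → Vec d × ℝ)}
    (hs : ∀ ω, trainError x y b₀ η α ω 0 ≤ Q * (n / δ) →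
      NearlyLinear (Matrix.toEuclideanLin (gramInf x)) η (α ^ 2 * √(n : ℝ))
        (10 * c * lambdaZero x / √κ) (budget m x c κ δ)
        (resSeq x y b₀ η α ω) (bSeq x y b₀ η α ω) → ω ∈ s) :
    1 - δ ≤ (initLaw d m).real s := by
  have hc := hK.c_pos
  have hK0 : 0 < K := by linarith [hK.four_le hC]
  have hnR : (0 : ℝ) < n := by exact_mod_cast hn
  have hm0 : 0 < m := by
    have hw : 0 < widthAbove x δ := by
      unfold widthAbove
      positivity
    have : (0 : ℝ) < m := lt_of_lt_of_le (by positivity) hm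
    exact_mod_cast this
  have hR : 0 < radius x c κ δ := by
    unfold radius
    have := Real.sqrt_pos.mpr hκ
    positivity
  refine one_sub_le_measureReal_of_goodInit hm0 hn hx hy hδ hR fun ω hω => hs ω ?_ ?_
  · rw [hK.Q_eq]
    exact hω.sqError_le
  · exact hω.nearlyLinear hx hm0 hn hlam hδ hδ1 hc hκ hb₀ hη
      (by linarith [hK.width, hK.six_le]) hm

theorem measureReal_convergence_above (hK : ConstantRelations Y Cmax Q c K) (hC : 1 ≤ C)
    (hCm : C ≤ Cmax) (hx : ∀ i, ‖x i‖ = 1) (hy : ∀ i, |y i| ≤ Y) (hn : 0 < n)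
    (hlam : 0 < lambdaZero x) (hb₀ : 0 < b₀) (hη : 0 < η) (hα : 0 < α) (hδ : 0 < δ) (hδ1 : δ < 1)
    (hb : threshold x C ≤ b₀ / η) (hm : K * widthAbove x δ ≤ m) :
    1 - δ ≤ (initLaw d m).real {ω |
      (∀ k : ℕ, trainError x y b₀ η α ω k ≤
        Real.exp (-(k / (K * scaleAbove x b₀ η α δ))) * trainError x y b₀ η α ω 0) ∧
      ∀ ε : ℝ, 0 < ε → ∀ k : ℕ,
        K * scaleAbove x b₀ η α δ * Real.log (1 + n / δ / ε) ≤ k →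
        trainError x y b₀ η α ω k ≤ ε} := by
  have hC0 : 0 ≤ Cmax := by linarith
  have hQ1 : 1 ≤ Q := by linarith [hK.six_le]
  have hc := hK.c_pos
  have hnR : (0 : ℝ) < n := by exact_mod_cast hn
  have hm1 : K * widthAbove x δ * 1 ≤ m := by rwa [mul_one]
  refine hK.one_sub_le_measureReal (b₀ := b₀) (η := η) (α := α) hC0 hx hy hn hlam hb₀ hη hδ hδ1
    one_pos hm1 fun ω hE hlin => ?_
  refine convergence_above hn hlin hlam hC hb₀ hη hα hδ (hK.error_le_half hlam le_rfl) hQ1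
    (hK.four_mul_sq_le hC0) hE ?_ hb
  -- without a warm-up only the contraction part of the budget is used
  have h1 := sqrt_add_sqrt_le_budget (N := n) (η := 0) (α := 1) (β := 1) (Lam := 0)
    (T := 0) (ℓ := 0) (Q := Q) hQ1 (by exact_mod_cast hn) one_pos (by norm_num) hlam hδ
    le_rfl le_rfl (budget_nonneg m x (κ := 1) hc hlam hδ) ?_
  · simpa using h1
  · refine le_trans ?_ (sq_budget_ge hn x one_pos hm1)
    have h2 : lambdaZero x ^ 2 * δ ^ 2 / n ^ 6 * widthAbove x δ
        = (n : ℝ) ^ 2 / (lambdaZero x ^ 2 * δ) := by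
      rw [widthAbove]
      field_simp
    rw [h2]
    have h3 : 0 ≤ (n : ℝ) ^ 2 / (lambdaZero x ^ 2 * δ) := by positivity
    have h4 := mul_le_mul_of_nonneg_right hK.width h3
    simpa using h4

theorem measureReal_convergence_below (hK : ConstantRelations Y Cmax Q c K) (hC : 1 ≤ C)
    (hCm : C ≤ Cmax) (hx : ∀ i, ‖x i‖ = 1) (hy : ∀ i, |y i| ≤ Y) (hn : 0 < n)
    (hlam : 0 < lambdaZero x) (hb₀ : 0 < b₀) (hη : 0 < η) (hα : 0 < α) (hδ : 0 < δ) (hδ1 : δ < 1)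
    (hb : b₀ / η < threshold x C) (hε : 0 < ε) (hm : K * widthBelow x C b₀ η α δ ε ≤ m) :
    1 - δ ≤ (initLaw d m).real {ω |
      (∃ k : ℕ, (k : ℝ) ≤ climb n α ε b₀ (η * threshold x C) ∧
        trainError x y b₀ η α ω k ≤ ε) ∨
      ∀ k : ℕ,
        climb n α ε b₀ (η * threshold x C)
          + K * scaleBelow x C b₀ η α δ
              * Real.log (1 + errorBelow x C b₀ η α δ / ε) ≤ k →
        trainError x y b₀ η α ω k ≤ ε} := by
  have hC0 : 0 ≤ Cmax := by linarith
  have hQ1 : 1 ≤ Q := by linarith [hK.six_le]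
  have hK0 : 0 < K := by linarith [hK.four_le hC0]
  have hnR : (0 : ℝ) < n := by exact_mod_cast hn
  have hm1 : K * widthBelow x C b₀ η α δ ε * 1 ≤ m := by rwa [mul_one]
  have hwb := widthAbove_le_widthBelow hb₀ hη hα hδ hb hε
  refine hK.one_sub_le_measureReal (b₀ := b₀) (η := η) (α := α) hC0 hx hy hn hlam hb₀ hη hδ hδ1
    one_pos (le_trans (by gcongr) hm1) fun ω hE hlin => ?_
  have hbB : b₀ ≤ η * threshold x C := by
    rw [div_lt_iff₀ hη] at hb
    linarith
  refine convergence_below hn hlin hlam hC hCm hb₀ hη hα hδ (hK.error_le_half hlam le_rfl)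
    hK.six_le hK.rate hE hb hε
    (budget_below hn hlam hb₀ hη hα hδ hQ1 hK.c_pos one_pos hK.width hb hε hm1)
    (climb_nonneg n hα hε hb₀ hbB) ?_
  intro k hk hj
  exact hlin.steps_le_climb (by positivity) hε 0 k (fun j _ hjk => (hj j (by omega)).le)
    (by rw [zero_add]; exact hk.le)

theorem measureReal_convergence_below_of_component (hK : ConstantRelations Y Cmax Q c K)
    (hC : 1 ≤ C) (hCm : C ≤ Cmax) (hx : ∀ i, ‖x i‖ = 1) (hy : ∀ i, |y i| ≤ Y) (hn : 0 < n)
    (hlam : 0 < lambdaZero x) (hb₀ : 0 < b₀) (hη : 0 < η) (hα : 0 < α) (hδ : 0 < δ) (hδ1 : δ < 1)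
    (hb : b₀ / η < threshold x C) (hε : 0 < ε) {v : Fin n → ℝ} {Δ b₁ : ℝ}
    (hv : v ⬝ᵥ v = 1) (hHv : (gramInf x).mulVec v = lambdaMax x • v) (hΔ : 0 < Δ)
    (hb₁ : b₁ = max b₀ (η * lambdaMax x / 2))
    (hm : K * widthBelow x C b₀ η α δ ε
      * (1 + n / (δ * Δ ^ 2) * (1 + climb n α (Δ ^ 2) b₀ b₁) ^ 2) ≤ m) :
    1 - δ ≤ (initLaw d m).real {ω |
      Δ ≤ |initComponent x y v ω| →
      (∃ k : ℕ,
        (k : ℝ) ≤ 1 + K * climb n α (Δ ^ 2) b₀ b₁ + climb n α ε b₁ (η * threshold x C) ∧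
        trainError x y b₀ η α ω k ≤ ε) ∨
      ∀ k : ℕ,
        1 + K * climb n α (Δ ^ 2) b₀ b₁ + climb n α ε b₁ (η * threshold x C)
            + K * scaleBelow x C b₀ η α δ
                * Real.log (1 + errorBelow x C b₀ η α δ / ε) ≤ k →
        trainError x y b₀ η α ω k ≤ ε} := by
  have hH := spectralBounds_gramInf hlam
  have hC0 : 0 ≤ Cmax := by linarith
  have hQ1 : 1 ≤ Q := by linarith [hK.six_le]
  have hc := hK.c_pos
  have hK4 := hK.four_le hC0
  have hK0 : 0 < K := by linarith
  have hnR : (0 : ℝ) < n := by exact_mod_cast hn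
  have hb01 : b₀ ≤ b₁ := hb₁ ▸ le_max_left _ _
  have hb1B : b₁ ≤ η * threshold x C := by
    rw [div_lt_iff₀ hη] at hb
    rw [hb₁]
    refine max_le (by linarith) ?_
    have h1 : lambdaMax x / 2 ≤ threshold x C := by
      rw [threshold]
      nlinarith [hH.le]
    have h2 := mul_le_mul_of_nonneg_left h1 hη.le
    linarith
  have hN0 := climb_nonneg n hα (pow_pos hΔ 2) hb₀ hb01
  have hclimb0 := climb_nonneg n hα hε (hb₀.trans_le hb01) hb1B
  set N := climb n α (Δ ^ 2) b₀ b₁ with hN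
  set κ : ℝ := 1 + n / (δ * Δ ^ 2) * (1 + N) ^ 2 with hκdef
  have hκ1 : 1 ≤ κ := le_add_of_nonneg_right (by positivity)
  have hκ0 : 0 < κ := by linarith
  have hwb := widthAbove_le_widthBelow hb₀ hη hα hδ hb hε
  refine hK.one_sub_le_measureReal (b₀ := b₀) (η := η) (α := α) hC0 hx hy hn hlam hb₀ hη hδ hδ1
    hκ0 (le_trans (by gcongr) hm) fun ω hE hlin hcomp => ?_
  have hbud := budget_below hn hlam hb₀ hη hα hδ hQ1 hc hκ0 hK.width hb hε hm
  set V : EuclideanSpace ℝ (Fin n) := WithLp.toLp 2 v with hVdef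
  have hV : ‖V‖ = 1 := by
    have h1 : ‖V‖ ^ 2 = 1 := by
      rw [EuclideanSpace.real_norm_sq_eq, ← hv]
      simp [hVdef, dotProduct, sq]
    exact (pow_eq_one_iff_of_nonneg (norm_nonneg _) two_ne_zero).mp h1
  have hHV : Matrix.toEuclideanLin (gramInf x) V = lambdaMax x • V := by
    apply WithLp.ofLp_injective 2
    simpa [hVdef] using hHv
  have hin : ⟪V, resSeq x y b₀ η α ω 0⟫ = initComponent x y v ω := by
    rw [initComponent, dotProduct_comm, PiLp.inner_apply]
    simp [hVdef, resVec, dotProduct, iterate]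
  have hloss := relative_loss_le (N := n) (κ := κ) hδ hΔ hN0 hQ1 hc hK.c_le hlam hH.le hκ0
    (by rw [hκdef]; linarith) (norm_nonneg (resSeq x y b₀ η α ω 0))
    (by rw [← trainError_eq]; exact hE)
  have hKN : 4 * N ≤ K * N := by gcongr
  refine convergence_below hn hlin hlam hC hCm hb₀ hη hα hδ (hK.error_le_half hlam hκ1) hK.six_le
    hK.rate hE hb hε hbud (by positivity) ?_
  intro k hk hj
  have h1 := hlin.le_two_stage_climb hH hη (by positivity) (by positivity) hV hHV hΔ
    (hin ▸ hcomp) hb₁ hN hloss hε hb1B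
    (le_trans (le_add_of_nonneg_right (by positivity)) hbud) k hk hj
  rw [← climb] at h1
  linarith

end ConstantRelations

end AdaLoss

end

theorem mainTheorem4 (Y Cmax : ℝ) :
    ∃ K : ℝ, 0 < K ∧
      ∀ (d n m : ℕ) (x : Fin n → AdaLoss.Vec d) (y : Fin n → ℝ),
        (∀ i, ‖x i‖ = 1) → (∀ i, |y i| ≤ Y) → 0 < AdaLoss.lambdaZero x →
      ∀ C b₀ η α δ : ℝ, 1 ≤ C → C ≤ Cmax → 0 < b₀ → 0 < η → 0 < α → 0 < δ → δ < 1 →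
        -- Case (1): `b₀ / η` is above the critical threshold.
        (AdaLoss.threshold x C ≤ b₀ / η →
          K * AdaLoss.widthAbove x δ ≤ m →
          1 - δ ≤ (AdaLoss.initLaw d m).real {ω |
            (∀ k : ℕ, AdaLoss.trainError x y b₀ η α ω k ≤
              Real.exp (-(k / (K * AdaLoss.scaleAbove x b₀ η α δ)))
                * AdaLoss.trainError x y b₀ η α ω 0) ∧
            ∀ ε : ℝ, 0 < ε → ∀ k : ℕ,
              K * AdaLoss.scaleAbove x b₀ η α δ * Real.log (1 + n / δ / ε) ≤ k →
              AdaLoss.trainError x y b₀ η α ω k ≤ ε}) ∧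
        -- Case (2): `b₀ / η` is below the critical threshold.
        (b₀ / η < AdaLoss.threshold x C →
          ∀ ε : ℝ, 0 < ε →
          (K * AdaLoss.widthBelow x C b₀ η α δ ε ≤ m →
            1 - δ ≤ (AdaLoss.initLaw d m).real {ω |
              (∃ k : ℕ, (k : ℝ) ≤ AdaLoss.climb n α ε b₀ (η * AdaLoss.threshold x C) ∧
                AdaLoss.trainError x y b₀ η α ω k ≤ ε) ∨
              ∀ k : ℕ,
                AdaLoss.climb n α ε b₀ (η * AdaLoss.threshold x C)
                  + K * AdaLoss.scaleBelow x C b₀ η α δ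
                      * Real.log (1 + AdaLoss.errorBelow x C b₀ η α δ / ε) ≤ k →
                AdaLoss.trainError x y b₀ η α ω k ≤ ε}) ∧
          -- Shorter warm-up when `y - u(0)` has a component of size `Δ` along a top eigenvector.
          (∀ (v : Fin n → ℝ) (Δ b₁ : ℝ),
            v ⬝ᵥ v = 1 →
            (AdaLoss.gramInf x).mulVec v = AdaLoss.lambdaMax x • v →
            0 < Δ →
            b₁ = max b₀ (η * AdaLoss.lambdaMax x / 2) →
            K * AdaLoss.widthBelow x C b₀ η α δ ε
                * (1 + n / (δ * Δ ^ 2) * (1 + AdaLoss.climb n α (Δ ^ 2) b₀ b₁) ^ 2) ≤ m →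
            1 - δ ≤ (AdaLoss.initLaw d m).real {ω |
              Δ ≤ |AdaLoss.initComponent x y v ω| →
              (∃ k : ℕ,
                (k : ℝ) ≤ 1 + K * AdaLoss.climb n α (Δ ^ 2) b₀ b₁
                    + AdaLoss.climb n α ε b₁ (η * AdaLoss.threshold x C) ∧
                AdaLoss.trainError x y b₀ η α ω k ≤ ε) ∨
              ∀ k : ℕ,
                1 + K * AdaLoss.climb n α (Δ ^ 2) b₀ b₁
                    + AdaLoss.climb n α ε b₁ (η * AdaLoss.threshold x C)
                    + K * AdaLoss.scaleBelow x C b₀ η α δ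
                        * Real.log (1 + AdaLoss.errorBelow x C b₀ η α δ / ε) ≤ k →
                AdaLoss.trainError x y b₀ η α ω k ≤ ε})) := by
  obtain ⟨Q, c, K, hK⟩ := AdaLoss.ConstantRelations.exists_of_nonneg Y (abs_nonneg Cmax)
  refine ⟨K, by linarith [hK.four_le (abs_nonneg Cmax)], ?_⟩
  intro d n m x y hx hy hlam C b₀ η α δ hC hCm hb₀ hη hα hδ hδ1
  have hCa : C ≤ |Cmax| := hCm.trans (le_abs_self _)
  have hn : 0 < n := by
    rcases Nat.eq_zero_or_pos n with rfl | hn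
    · rw [AdaLoss.lambdaZero_eq_zero_of_isEmpty] at hlam
      exact absurd hlam (lt_irrefl _)
    · exact hn
  exact ⟨hK.measureReal_convergence_above hC hCa hx hy hn hlam hb₀ hη hα hδ hδ1,
    fun hb ε hε =>
      ⟨hK.measureReal_convergence_below hC hCa hx hy hn hlam hb₀ hη hα hδ hδ1 hb hε,
        fun v Δ b₁ hv hHv hΔ hb₁ => hK.measureReal_convergence_below_of_component hC hCa hx hy hn
          hlam hb₀ hη hα hδ hδ1 hb hε hv hHv hΔ hb₁⟩⟩
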